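/- Let $G$ be a finite group. A triple $(G,N,M)$ is a \emph{Frobenius triple} if $M\le N$ are nontrivial proper normal subgroups of $G$ and $C_G(x)\le N$ for every $1\ne x\in M$. Call $G$ a \emph{Frobenius group} if it has a nontrivial normal subgroup $K$ (a Frobenius kernel) that has a nontrivial complement in $G$ and satisfies $C_G(x)\le K$ for every $1\ne x\in K$. For normal subgroups $M,N$ of $G$ put \[ C(G\mid M)=\langle C_G(x) : 1\ne x\in M\rangle,\qquad I(G\mid N)=\prod\{M\lhd G : C(G\mid M)\le N\}. \] Let $\mathrm{Irr}(G\mid M)$ be the set of irreducible complex characters of $G$ whose kernel does not contain $M$; for a character $\chi$ let $V(\chi)$ be the smallest subgroup of $G$ outside of which $\chi$ vanishes; and put \[ V(G\mid M)=\prod_{\chi\in\mathrm{Irr}(G\mid M)}V(\chi),\qquad U(G\mid N)=\prod\{M\lhd G : V(G\mid M)\le N\}. \] Let $F(G)$ denote the Fitting subgroup, $Z(G)$ the center and $G'$ the commutator subgroup of $G$. Then $C(G\mid M)$ and $I(G\mid N)$ are normal in $G$ for all normal subgroups $M,N$ of $G$, and the following hold for all normal subgroups $M,M_1,M_2,N,N_1,N_2$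 of $G$: \begin{enumerate} \item[(1)] $C(G\mid M)\le N$ if and only if $M\le I(G\mid N)$; \item[(2)] $C(G\mid M_1M_2)=C(G\mid M_1)\,C(G\mid M_2)$; \item[(3)] $I(G\mid N_1\cap N_2)=I(G\mid N_1)\cap I(G\mid N_2)$; \item[(4)] $M\le I(G\mid C(G\mid M))$ and $C(G\mid I(G\mid N))\le N$; \item[(5)] if $N<G$, then $Z(G)\cap I(G\mid N)=1$; \item[(6)] if $M>1$ and $N<G$, then $(G,N,M)$ is a Frobenius triple if and only if $C(G\mid M)\le N$; \item[(7)] $G$ is a Frobenius group if and only if $1<F(G)<G$ and $C(G\mid F(G))=F(G)$, and also if and only if $1<F(G)<G$ and $F(G)=I(G\mid F(G))$; \item[(8)] if $M>1$, then $Z(G)M\le V(G\mid M)\le C(G\mid M)$; if $N<G$, then $I(G\mid N)\le U(G\mid N)\le N\cap G'$. \end{enumerate} -/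

import Mathlib

namespace FrobeniusTriple

variable {G : Type*} [Group G]

/-- `(G, N, M)` is a Frobenius triple: `M ≤ N` are nontrivial proper normal subgroups of `G` and
`C_G(x) ≤ N` for every `1 ≠ x ∈ M`. -/
structure IsFrobeniusTriple (N M : Subgroup G) : Prop where
  normal_top : N.Normal
  normal_bot : M.Normal
  top_ne_bot : N ≠ ⊥
  top_ne_top : N ≠ ⊤
  bot_ne_bot : M ≠ ⊥
  bot_ne_top : M ≠ ⊤
  le : M ≤ N
  centralizer_le : ∀ x ∈ M, x ≠ 1 → Subgroup.centralizer {x} ≤ N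

/-- `G` is a Frobenius group with Frobenius kernel `N`: the normal subgroup `N` is nontrivial, has
a nontrivial complement in `G`, and `C_G(x) ≤ N` for every `1 ≠ x ∈ N`. -/
structure IsFrobeniusKernel (N : Subgroup G) : Prop where
  normal : N.Normal
  ne_bot : N ≠ ⊥
  exists_compl : ∃ H : Subgroup G, H ≠ ⊥ ∧ N.IsComplement' H
  centralizer_le : ∀ x ∈ N, x ≠ 1 → Subgroup.centralizer {x} ≤ N

variable (G) in
/-- `G` is a Frobenius group. -/
def IsFrobeniusGroup : Prop := ∃ N : Subgroup G, IsFrobeniusKernel N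

variable (G) in
/-- The Fitting subgroup `F(G)`: the product of all nilpotent normal subgroups of `G`. -/
def fitting : Subgroup G :=
  sSup {K : Subgroup G | K.Normal ∧ Group.IsNilpotent K}

/-- `C(G|M) = ⟨C_G(x) : 1 ≠ x ∈ M⟩`. -/
def C (M : Subgroup G) : Subgroup G :=
  ⨆ x ∈ {x : G | x ∈ M ∧ x ≠ 1}, Subgroup.centralizer {x}

/-- `I(G|N)`: the product of all normal subgroups `M` of `G` with `C(G|M) ≤ N`. -/
def I (N : Subgroup G) : Subgroup G :=
  sSup {M : Subgroup G | M.Normal ∧ C M ≤ N}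

variable (G) in
/-- `Irr(G)`: the characters of the irreducible complex representations of `G` of finite
dimension (up to isomorphism, these live on some `ℂⁿ`). -/
def Irr : Set (G → ℂ) :=
  {χ | ∃ (n : ℕ) (ρ : Representation ℂ G (Fin n → ℂ)), ρ.IsIrreducible ∧ χ = ρ.character}

/-- The kernel `{g : χ(g) = χ(1)}` of a character, as a set. -/
def charKer (χ : G → ℂ) : Set G := {g | χ g = χ 1}

/-- `Irr(G|M)`: the irreducible characters of `G` whose kernel does not contain `M`. -/
def IrrOver (M : Subgroup G) : Set (G → ℂ) :=
  {χ | χ ∈ Irr G ∧ ¬ (M : Set G) ⊆ charKer χ}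

/-- The vanishing-off subgroup `V(χ)`: the smallest subgroup of `G` outside of which `χ`
vanishes, that is, the subgroup generated by the elements at which `χ` is nonzero. -/
def vanishingOff (χ : G → ℂ) : Subgroup G := Subgroup.closure {g | χ g ≠ 0}

/-- `V(G|M)`: the product of the subgroups `V(χ)` for `χ ∈ Irr(G|M)`. -/
def V (M : Subgroup G) : Subgroup G := ⨆ χ ∈ IrrOver M, vanishingOff χ

/-- `U(G|N)`: the product of all normal subgroups `M` of `G` with `V(G|M) ≤ N`. -/
def U (N : Subgroup G) : Subgroup G :=
  sSup {M : Subgroup G | M.Normal ∧ V M ≤ N}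

end FrobeniusTriple

/-! ### The maps C and I on normal subgroups. -/

namespace FrobeniusTriple

section Lattice

variable {G : Type*} [Group G]

/-! For `M` normal in the finite group `G`, the self-map `t ↦ y⁻¹tyt⁻¹` of `M` is injective exactly
when `y` centralizes no nontrivial element of `M`, and surjective exactly when all of `yM` is
conjugate to `y` under `M`. So `C(G|M) ≤ N` says that every `y` outside `N` is `M`-conjugate to all
of `yM` (`forall_exists_conj_iff`). In this form the condition passes to products: move `y` to `ym₁`
by `M₁`, then to `ym₁m₂` by `M₂`. Hence `I(G|N)` itself satisfies it, and `C` and `I` form a Galois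
connection.

A character in `Irr(G|M)` sums to zero over each coset of `M`; outside `C(G|M)` it is also constant
on the coset, so it vanishes there and `V ≤ C`. The regular character forces `M ≤ V`, Schur's lemma
gives `Z(G) ≤ V`, and if `M` is not in `G'`, a linear character nontrivial on `M` vanishes nowhere,
so `V(G|M) = G`.

For the Frobenius criterion, `C(G|F) = F` makes `F` a Hall subgroup, and Schur–Zassenhaus supplies a
complement. The converse needs Thompson's theorem that a Frobenius kernel is nilpotent; it is then
the Fitting subgroup. An element of prime order in the complement acts on the kernel without fixed
points, so `isNilpotent_of_fixedPointFree` applies. By `commute_of_coprime`, a minimal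
counterexample to that theorem has no proper nontrivial invariant normal subgroup. For an invariant
Sylow `q`-subgroup `P` with `q` odd, the normalizers of `Z(P)` and `J(P)` are then proper and
invariant, so nilpotent by induction, and Thompson's criterion `isPNilpotent_top_of_normalizer`
gives an invariant normal `q`-complement, a contradiction. The criterion rests on Frobenius'
`p`-complement theorem, Thompson's replacement theorem and an argument on quadratic action. -/

theorem C_le_iff {M N : Subgroup G} :
    C M ≤ N ↔ ∀ x ∈ M, x ≠ 1 → ∀ y, x * y = y * x → y ∈ N := by
  simp only [C, iSup_le_iff, Set.mem_ofPred_eq, and_imp]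
  refine forall_congr' fun x => forall_congr' fun _ => forall_congr' fun _ => ?_
  exact forall_congr' fun y => by rw [Subgroup.mem_centralizer_singleton_iff]; tauto

theorem mem_C {M : Subgroup G} {x y : G} (hx : x ∈ M) (h1 : x ≠ 1) (h : x * y = y * x) :
    y ∈ C M :=
  C_le_iff.1 le_rfl x hx h1 y h

theorem le_C (M : Subgroup G) : M ≤ C M := fun x hx => by
  by_cases h : x = 1
  · rw [h]; exact one_mem _
  · exact mem_C hx h rfl

theorem C_mono {M₁ M₂ : Subgroup G} (h : M₁ ≤ M₂) : C M₁ ≤ C M₂ :=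
  C_le_iff.2 fun _ hx h1 _ hy => mem_C (h hx) h1 hy

theorem C_normal {M : Subgroup G} (hM : M.Normal) : (C M).Normal := by
  refine ⟨fun n hn g => ?_⟩
  have : C M ≤ (C M).comap (MulAut.conj g).toMonoidHom := by
    refine C_le_iff.2 fun x hx h1 y hy => ?_
    refine mem_C (hM.conj_mem x hx g) (by simpa using h1) ?_
    simp only [MulEquiv.toMonoidHom_eq_coe, MonoidHom.coe_coe, MulAut.conj_apply]
    calc g * x * g⁻¹ * (g * y * g⁻¹) = g * (x * y) * g⁻¹ := by group
      _ = g * y * g⁻¹ * (g * x * g⁻¹) := by rw [hy]; group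
  exact this hn

theorem sSup_normal {S : Set (Subgroup G)} (hS : ∀ M ∈ S, M.Normal) : (sSup S).Normal := by
  rw [sSup_eq_iSup']
  have : ∀ i : S, (i : Subgroup G).Normal := fun i => hS i i.2
  exact Subgroup.iSup_normal _

theorem I_normal (N : Subgroup G) : (I N).Normal :=
  sSup_normal fun _ hM => hM.1

/-- The elements of the coset `yM` are conjugate to `y` under `M` if and only if `y` centralizes
no nontrivial element of `M`. -/
theorem forall_exists_conj_iff [Finite G] {M : Subgroup G} (hM : M.Normal) (y : G) :
    (∀ m ∈ M, ∃ t ∈ M, t * y * t⁻¹ = y * m) ↔ ∀ x ∈ M, x * y = y * x → x = 1 := by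
  let f : M → M := fun t => ⟨y⁻¹ * t * y * (t : G)⁻¹,
    M.mul_mem (by simpa using hM.conj_mem t t.2 y⁻¹) (M.inv_mem t.2)⟩
  have hf : (∀ m ∈ M, ∃ t ∈ M, t * y * t⁻¹ = y * m) ↔ Function.Surjective f := by
    constructor
    · rintro h ⟨m, hm⟩
      obtain ⟨t, ht, h⟩ := h m hm
      refine ⟨⟨t, ht⟩, Subtype.ext ?_⟩
      simp only [f]
      rw [← inv_mul_cancel_left y m, ← h]; group
    · intro h m hm
      obtain ⟨⟨t, ht⟩, h⟩ := h ⟨m, hm⟩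
      refine ⟨t, ht, ?_⟩
      have h : y⁻¹ * t * y * t⁻¹ = m := congrArg Subtype.val h
      rw [← h]; group
  rw [hf, ← Finite.injective_iff_surjective]
  constructor
  · intro h x hx hxy
    have : (⟨x, hx⟩ : M) = 1 := h (Subtype.ext (by
      simp only [f, mul_assoc, hxy]; simp))
    exact congrArg Subtype.val this
  · rintro h ⟨s, hs⟩ ⟨t, ht⟩ hst
    have hst : y⁻¹ * s * y * s⁻¹ = y⁻¹ * t * y * t⁻¹ := congrArg Subtype.val hst
    have := h (t⁻¹ * s) (M.mul_mem (M.inv_mem ht) hs) (by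
      calc t⁻¹ * s * y = t⁻¹ * y * (y⁻¹ * s * y * s⁻¹) * s := by group
        _ = _ := by rw [hst]; group)
    exact Subtype.ext (inv_mul_eq_one.1 this).symm

theorem C_le_iff_forall_notMem {M N : Subgroup G} :
    C M ≤ N ↔ ∀ y ∉ N, ∀ x ∈ M, x * y = y * x → x = 1 := by
  rw [C_le_iff]
  constructor
  · intro h y hy x hx hxy
    by_contra h1
    exact hy (h x hx h1 y hxy)
  · intro h x hx h1 y hxy
    by_contra hy
    exact h1 (h y hy x hx hxy)

theorem isFrobeniusTriple_iff {M N : Subgroup G} (hM : M.Normal) (hN : N.Normal) (h1 : M ≠ ⊥)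
    (hN1 : N ≠ ⊤) : IsFrobeniusTriple N M ↔ C M ≤ N := by
  constructor
  · intro h
    simp only [C, iSup_le_iff, Set.mem_ofPred_eq, and_imp]
    exact h.centralizer_le
  · intro h
    have hle := (le_C M).trans h
    refine ⟨hN, hM, ?_, hN1, h1, ?_, hle, ?_⟩
    · rintro rfl
      exact h1 (le_bot_iff.1 hle)
    · rintro rfl
      exact hN1 (top_le_iff.1 hle)
    · simpa only [C, iSup_le_iff, Set.mem_ofPred_eq, and_imp] using h

variable [Finite G]

theorem C_sup_le {M₁ M₂ N : Subgroup G} (h₁ : M₁.Normal) (h₂ : M₂.Normal)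
    (hC₁ : C M₁ ≤ N) (hC₂ : C M₂ ≤ N) : C (M₁ ⊔ M₂) ≤ N := by
  have h₁₂ : (M₁ ⊔ M₂).Normal := inferInstance
  refine C_le_iff_forall_notMem.2 fun y hy => (forall_exists_conj_iff h₁₂ y).1 fun m hm => ?_
  obtain ⟨m₁, hm₁, m₂, hm₂, rfl⟩ := Subgroup.mem_sup_of_normal_left.1 hm
  obtain ⟨t, ht, hty⟩ :=
    (forall_exists_conj_iff h₁ y).2 (C_le_iff_forall_notMem.1 hC₁ y hy) m₁ hm₁
  -- Multiplying by `m₁ ∈ N` does not change the coset of `N`, so the conjugation argument applies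
  -- again.
  have hy' : y * m₁ ∉ N := fun h =>
    hy ((N.mul_mem_cancel_right ((le_C M₁).trans hC₁ hm₁)).1 h)
  obtain ⟨s, hs, hsy⟩ :=
    (forall_exists_conj_iff h₂ _).2 (C_le_iff_forall_notMem.1 hC₂ _ hy') m₂ hm₂
  refine ⟨s * t, mul_mem (Subgroup.mem_sup_right hs) (Subgroup.mem_sup_left ht), ?_⟩
  calc s * t * y * (s * t)⁻¹ = s * (t * y * t⁻¹) * s⁻¹ := by group
    _ = _ := by rw [hty, hsy, mul_assoc]

theorem C_sSup_le {S : Set (Subgroup G)} {N : Subgroup G} (hS : ∀ M ∈ S, M.Normal ∧ C M ≤ N) :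
    C (sSup S) ≤ N := by
  induction S, S.toFinite using Set.Finite.induction_on with
  | empty =>
    refine C_le_iff.2 fun x hx h1 => ?_
    rw [sSup_empty, Subgroup.mem_bot] at hx
    exact absurd hx h1
  | insert _ _ ih =>
    rw [sSup_insert]
    have h := fun M hM => hS M (Set.mem_insert_of_mem _ hM)
    exact C_sup_le (hS _ (Set.mem_insert _ _)).1 (sSup_normal fun M hM => (h M hM).1)
      (hS _ (Set.mem_insert _ _)).2 (ih h)

theorem C_I_le (N : Subgroup G) : C (I N) ≤ N :=
  C_sSup_le fun _ hM => hM

theorem C_le_iff_le_I {M N : Subgroup G} (hM : M.Normal) : C M ≤ N ↔ M ≤ I N :=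
  ⟨fun h => le_sSup ⟨hM, h⟩, fun h => (C_mono h).trans (C_I_le N)⟩

theorem I_mono {N₁ N₂ : Subgroup G} (h : N₁ ≤ N₂) : I N₁ ≤ I N₂ :=
  (C_le_iff_le_I (I_normal N₁)).1 ((C_I_le N₁).trans h)

theorem C_sup {M₁ M₂ : Subgroup G} (h₁ : M₁.Normal) (h₂ : M₂.Normal) :
    C (M₁ ⊔ M₂) = C M₁ ⊔ C M₂ :=
  le_antisymm (C_sup_le h₁ h₂ le_sup_left le_sup_right)
    (sup_le (C_mono le_sup_left) (C_mono le_sup_right))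

theorem I_inf (N₁ N₂ : Subgroup G) : I (N₁ ⊓ N₂) = I N₁ ⊓ I N₂ := by
  refine le_antisymm (le_inf (I_mono inf_le_left) (I_mono inf_le_right)) ?_
  have h₁ := I_normal N₁
  have h₂ := I_normal N₂
  have h : (I N₁ ⊓ I N₂).Normal := inferInstance
  exact (C_le_iff_le_I h).1 (le_inf ((C_mono inf_le_left).trans (C_I_le N₁))
    ((C_mono inf_le_right).trans (C_I_le N₂)))

theorem center_inf_I {N : Subgroup G} (hN : N ≠ ⊤) : Subgroup.center G ⊓ I N = ⊥ := by
  refine (Subgroup.eq_bot_iff_forall _).2 fun x hx => ?_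
  by_contra h1
  exact hN (eq_top_iff.2 fun y _ =>
    C_I_le N (mem_C hx.2 h1 (Subgroup.mem_center_iff.1 hx.1 y).symm))

end Lattice

end FrobeniusTriple

/-! ### Irreducible characters and vanishing-off subgroups. -/

namespace FrobeniusTriple

section Characters

open Representation

variable {G : Type*} [Group G]

theorem eq_bot_or_eq_top_of_isIrreducible {V : Type*} [AddCommGroup V] [Module ℂ V]
    {ρ : Representation ℂ G V} (hρ : ρ.IsIrreducible) (W : Submodule ℂ V)
    (hW : ∀ g, ∀ v ∈ W, ρ g v ∈ W) : W = ⊥ ∨ W = ⊤ := by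
  rcases hρ.eq_bot_or_eq_top ⟨W, fun g v hv => hW g v hv⟩ with h | h
  · exact Or.inl (congrArg Subrepresentation.toSubmodule h)
  · exact Or.inr (congrArg Subrepresentation.toSubmodule h)

theorem nontrivial_of_isIrreducible {V : Type*} [AddCommGroup V] [Module ℂ V]
    {ρ : Representation ℂ G V} (hρ : ρ.IsIrreducible) : Nontrivial V := by
  by_contra h
  rw [not_nontrivial_iff_subsingleton] at h
  exact hρ.exists_pair_ne.elim fun a ⟨b, hab⟩ =>
    hab (Subrepresentation.toSubmodule_injective (Subsingleton.elim _ _))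

/-- The character of a representation in a finite dimensional space is a sum of irreducible
characters. -/
theorem character_mem_closure_Irr [Finite G] (n : ℕ) :
    ∀ {V : Type*} [AddCommGroup V] [Module ℂ V] [FiniteDimensional ℂ V]
      (ρ : Representation ℂ G V), Module.finrank ℂ V = n →
      ρ.character ∈ AddSubmonoid.closure (Irr G) := by
  induction n using Nat.strong_induction_on with
  | _ n ih =>
  intro V _ _ _ ρ hn
  by_cases hV : Subsingleton V
  · convert! AddSubmonoid.zero_mem _
    ext g
    simp [character, Subsingleton.elim (ρ g) 0]
  rw [not_subsingleton_iff_nontrivial] at hV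
  have hnt : Nontrivial (Subrepresentation ρ) := by
    refine ⟨⊥, ⊤, fun h => ?_⟩
    exact bot_ne_top (α := Submodule ℂ V) (congrArg Subrepresentation.toSubmodule h)
  by_cases hirr : ρ.IsIrreducible
  · refine AddSubmonoid.subset_closure ?_
    -- `Irr G` only sees representations on `Fin n → ℂ`, so `ρ` is transported along a basis.
    let e : V ≃ₗ[ℂ] (Fin n → ℂ) := (Module.finBasisOfFinrankEq ℂ V hn).equivFun
    let σ : Representation ℂ G (Fin n → ℂ) :=
      (e.conjAlgEquiv ℂ : Module.End ℂ V →* Module.End ℂ (Fin n → ℂ)).comp ρ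
    have hσ : ∀ g, σ g = e.conj (ρ g) := fun g => rfl
    have hσ' : ∀ g v, σ g v = e (ρ g (e.symm v)) := fun g v => rfl
    refine ⟨n, σ, ?_, ?_⟩
    · have : Nontrivial (Subrepresentation σ) := by
        refine ⟨⊥, ⊤, fun h => ?_⟩
        have h' := congrArg Subrepresentation.toSubmodule h
        have : Nontrivial (Fin n → ℂ) := e.symm.toEquiv.nontrivial
        exact bot_ne_top (α := Submodule ℂ (Fin n → ℂ)) h'
      refine ⟨fun W => ?_⟩
      rcases eq_bot_or_eq_top_of_isIrreducible hirr (W.toSubmodule.comap e.toLinearMap)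
        (fun g v hv => by
          have := W.apply_mem_toSubmodule g hv
          simpa [hσ'] using this) with h | h
      · left
        refine Subrepresentation.toSubmodule_injective ?_
        have := congrArg (Submodule.map e.toLinearMap) h
        rwa [Submodule.map_comap_eq_of_surjective e.surjective, Submodule.map_bot] at this
      · right
        refine Subrepresentation.toSubmodule_injective ?_
        have := congrArg (Submodule.map e.toLinearMap) h
        rw [Submodule.map_comap_eq_of_surjective e.surjective, Submodule.map_top,
          LinearEquiv.range] at this
        exact this
    · ext g
      rw [character, character, hσ, LinearMap.trace_conj']
  · obtain ⟨W, hW⟩ : ∃ W : Subrepresentation ρ, ¬ (W = ⊥ ∨ W = ⊤) := by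
      by_contra! h
      exact hirr ⟨fun W => h W⟩
    rw [not_or] at hW
    -- The hypothesis of Maschke's theorem, which supplies the complement `W'`.
    have : NeZero (Nat.card G : ℂ) := ⟨Nat.cast_ne_zero.2 Nat.card_pos.ne'⟩
    obtain ⟨W', hc⟩ := exists_isCompl W
    have hcs : IsCompl W.toSubmodule W'.toSubmodule := by
      refine IsCompl.of_eq ?_ ?_
      · exact congrArg Subrepresentation.toSubmodule hc.inf_eq_bot
      · exact congrArg Subrepresentation.toSubmodule hc.sup_eq_top
    have hlt : Module.finrank ℂ W.toSubmodule < n :=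
      hn ▸ Submodule.finrank_lt (fun h => hW.2 (Subrepresentation.toSubmodule_injective h))
    have hlt' : Module.finrank ℂ W'.toSubmodule < n := by
      have h0 : 0 < Module.finrank ℂ W.toSubmodule := by
        rw [Nat.pos_iff_ne_zero]
        intro h
        exact hW.1 (Subrepresentation.toSubmodule_injective (Submodule.finrank_eq_zero.1 h))
      have := Submodule.finrank_add_eq_of_isCompl hcs
      omega
    have hsum : ρ.character = W.toRepresentation.character + W'.toRepresentation.character := by
      ext g
      have := LinearMap.trace_eq_sum_trace_restrict (N := fun b : Bool =>
        bif b then W.toSubmodule else W'.toSubmodule)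
        ((DirectSum.isInternal_submodule_iff_isCompl _ (i := true) (j := false) (by simp)
          (by ext b; cases b <;> simp)).2 hcs) (f := ρ g) (by
          rintro (_ | _)
          · exact fun v hv => W'.apply_mem_toSubmodule g hv
          · exact fun v hv => W.apply_mem_toSubmodule g hv)
      rw [Fintype.sum_bool] at this
      exact this
    rw [hsum]
    exact add_mem (ih _ hlt W.toRepresentation rfl) (ih _ hlt' W'.toRepresentation rfl)

theorem ne_zero_of_mem_center {χ : G → ℂ} (hχ : χ ∈ Irr G) {z : G}
    (hz : z ∈ Subgroup.center G) : χ z ≠ 0 := by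
  obtain ⟨n, ρ, hρ, rfl⟩ := hχ
  have := nontrivial_of_isIrreducible hρ
  obtain ⟨c, hc⟩ := Module.End.exists_eigenvalue (ρ z)
  -- Schur's lemma: an eigenspace of `ρ z` is invariant because `z` is central, so `ρ z` is a
  -- scalar.
  rcases eq_bot_or_eq_top_of_isIrreducible hρ (Module.End.eigenspace (ρ z) c) (by
    intro g v hv
    rw [Module.End.mem_eigenspace_iff] at hv ⊢
    rw [← map_smul, ← hv, ← Module.End.mul_apply, ← Module.End.mul_apply, ← map_mul, ← map_mul,
      Subgroup.mem_center_iff.1 hz g]) with h | h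
  · exact absurd h hc
  · have hρz : ρ z = c • 1 := by
      refine LinearMap.ext fun v => ?_
      exact Module.End.mem_eigenspace_iff.1 (h ▸ Submodule.mem_top)
    have hc0 : c ≠ 0 := by
      rintro rfl
      have h10 : (1 : Module.End ℂ (Fin n → ℂ)) = 0 := by
        rw [← map_one ρ, ← mul_inv_cancel z, map_mul, hρz, zero_smul, zero_mul]
      exact one_ne_zero h10
    have hn : n ≠ 0 := by
      rintro rfl
      exact not_subsingleton (Fin 0 → ℂ) inferInstance
    rw [character, hρz, map_smul, LinearMap.trace_one]
    simp [hc0, hn]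

/-- A homomorphism `G →* ℂˣ` is an irreducible character. -/
theorem linear_mem_Irr (φ : G →* ℂˣ) : (fun g => (φ g : ℂ)) ∈ Irr G := by
  let ρ : Representation ℂ G (Fin 1 → ℂ) :=
    ((algebraMap ℂ (Module.End ℂ (Fin 1 → ℂ)) : ℂ →* _).comp (Units.coeHom ℂ)).comp φ
  have hρ : ∀ g, ρ g = (φ g : ℂ) • 1 := fun g =>
    Algebra.algebraMap_eq_smul_one (A := Module.End ℂ (Fin 1 → ℂ)) (φ g : ℂ)
  refine ⟨1, ρ, ?_, ?_⟩
  · have hs : IsSimpleModule ℂ (Fin 1 → ℂ) := isSimpleModule_iff_finrank_eq_one.2 (by simp)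
    have : Nontrivial (Subrepresentation ρ) := by
      refine ⟨⊥, ⊤, fun h => ?_⟩
      exact bot_ne_top (α := Submodule ℂ (Fin 1 → ℂ)) (congrArg Subrepresentation.toSubmodule h)
    refine ⟨fun W => ?_⟩
    rcases hs.eq_bot_or_eq_top W.toSubmodule with h | h
    · exact Or.inl (Subrepresentation.toSubmodule_injective h)
    · exact Or.inr (Subrepresentation.toSubmodule_injective h)
  · ext g
    rw [character, hρ, map_smul, LinearMap.trace_one]
    simp

section Average

variable [Finite G]

/-- If the kernel of an irreducible character `χ` does not contain the normal subgroup `M`, then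
the values of `χ` on each coset of `M` add up to zero. -/
theorem finsum_coset_eq_zero {M : Subgroup G} (hM : M.Normal) {χ : G → ℂ} (hχ : χ ∈ IrrOver M)
    (g : G) : ∑ᶠ m : M, χ (g * m) = 0 := by
  obtain ⟨⟨n, ρ, hρ, rfl⟩, hker⟩ := hχ
  have := Fintype.ofFinite M
  -- The image of `e` is invariant under `G` and fixed pointwise by `M`. It is not the whole space,
  -- as `M` is not in the kernel, so `e = 0`.
  let e : Module.End ℂ (Fin n → ℂ) := ∑ m : M, ρ m
  have he : ∀ m : M, ρ m * e = e := fun m => by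
    simp only [e, Finset.mul_sum, ← map_mul]
    exact Fintype.sum_equiv (Equiv.mulLeft m) _ _ fun x => by simp
  have hcomm : ∀ g, ρ g * e = e * ρ g := fun g => by
    simp only [e, Finset.mul_sum, Finset.sum_mul, ← map_mul]
    refine Fintype.sum_equiv (MulAut.conjNormal g : MulAut M).toEquiv _ _ fun x => ?_
    simp
  have he0 : e = 0 := by
    rcases eq_bot_or_eq_top_of_isIrreducible hρ (LinearMap.range e) (by
      rintro g _ ⟨v, rfl⟩
      exact ⟨ρ g v, (LinearMap.congr_fun (hcomm g) v).symm⟩) with h | h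
    · exact LinearMap.range_eq_bot.1 h
    · refine absurd (fun m hm => ?_) hker
      have : ρ m = 1 := by
        refine LinearMap.ext fun v => ?_
        obtain ⟨w, rfl⟩ : v ∈ LinearMap.range e := h ▸ Submodule.mem_top
        exact LinearMap.congr_fun (he ⟨m, hm⟩) w
      simp [charKer, character, this]
  rw [finsum_eq_sum_of_fintype]
  have : ∑ m : M, ρ.character (g * m) = LinearMap.trace ℂ _ (ρ g * e) := by
    simp only [e, character, Finset.mul_sum, map_sum, map_mul]
  rw [this, he0, mul_zero, map_zero]

theorem V_le_C {M : Subgroup G} (hM : M.Normal) : V M ≤ C M := by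
  refine iSup₂_le fun χ hχ => (Subgroup.closure_le _).2 fun g hg => ?_
  by_contra hgC
  refine hg ?_
  have := Fintype.ofFinite M
  have h0 := finsum_coset_eq_zero hM hχ g
  obtain ⟨⟨n, ρ, hρ, rfl⟩, hker⟩ := hχ
  have hconst : ∀ m : M, ρ.character (g * m) = ρ.character g := fun m => by
    obtain ⟨t, -, ht⟩ := (forall_exists_conj_iff hM g).2
      (C_le_iff_forall_notMem.1 le_rfl g hgC) m m.2
    rw [← ht, char_conj]
  rw [finsum_eq_sum_of_fintype] at h0
  simpa [hconst] using h0

/-- The regular representation of `G` in the space of complex functions on `G`. -/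
noncomputable def regularRep (G : Type*) [Group G] : Representation ℂ G (G → ℂ) where
  toFun g := LinearMap.funLeft ℂ ℂ (fun h => g⁻¹ * h)
  map_one' := by ext; simp [LinearMap.funLeft]
  map_mul' a b := by ext; simp [LinearMap.funLeft, mul_assoc]

theorem character_regularRep_one : (regularRep G).character 1 = Nat.card G := by
  have := Fintype.ofFinite G
  simp [char_one]

theorem character_regularRep_of_ne_one {g : G} (hg : g ≠ 1) : (regularRep G).character g = 0 := by
  classical
  have := Fintype.ofFinite G
  rw [character, LinearMap.trace_eq_matrix_trace ℂ (Pi.basisFun ℂ G), Matrix.trace]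
  refine Finset.sum_eq_zero fun h _ => ?_
  simp [regularRep, LinearMap.funLeft, hg]

/-- If all of `Irr(G|M)` vanished at `x`, every irreducible `χ` would satisfy `∑ χ(m) = |M| χ(x)`:
either `χ` is constant on `M`, or both sides are zero. By additivity this would hold for the regular
character, where the left side is `|G|` and the right side is `0`. -/
theorem exists_mem_IrrOver_ne_zero {M : Subgroup G} (hM : M.Normal) {x : G} (hx : x ∈ M)
    (h1 : x ≠ 1) : ∃ χ ∈ IrrOver M, χ x ≠ 0 := by
  by_contra! hv
  have := Fintype.ofFinite M
  have key : ∀ χ ∈ AddSubmonoid.closure (Irr G), ∑ m : M, χ m = Nat.card M * χ x := by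
    intro χ hχ
    induction hχ using AddSubmonoid.closure_induction with
    | mem χ hχ =>
      by_cases hk : (M : Set G) ⊆ charKer χ
      · have hc : ∀ m : M, χ m = χ x := fun m => (hk m.2).trans (hk hx).symm
        simp [hc]
      · have h0 := finsum_coset_eq_zero hM ⟨hχ, hk⟩ 1
        rw [finsum_eq_sum_of_fintype] at h0
        rw [hv χ ⟨hχ, hk⟩, mul_zero]
        simpa using h0
    | zero => simp
    | add χ ψ _ _ h h' => simp [Finset.sum_add_distrib, h, h', mul_add]
  have h := key _ (character_mem_closure_Irr _ (regularRep G) rfl)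
  rw [character_regularRep_of_ne_one h1, mul_zero,
    Fintype.sum_eq_single (1 : M) fun m hm => character_regularRep_of_ne_one (by simpa using hm),
    OneMemClass.coe_one, character_regularRep_one] at h
  exact Nat.card_pos.ne' (Nat.cast_eq_zero.1 h)

theorem center_sup_le_V {M : Subgroup G} (hM : M.Normal) (h1 : M ≠ ⊥) :
    Subgroup.center G ⊔ M ≤ V M := by
  have hV : ∀ χ ∈ IrrOver M, ∀ g, χ g ≠ 0 → g ∈ V M := fun χ hχ g hg =>
    (le_iSup₂ (f := fun χ (_ : χ ∈ IrrOver M) => vanishingOff χ) χ hχ)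
      (Subgroup.subset_closure hg)
  refine sup_le (fun z hz => ?_) fun x hx => ?_
  · obtain ⟨x, hx, hx1⟩ := (Subgroup.ne_bot_iff_exists_ne_one.1 h1).elim
      fun a ha => (⟨a, a.2, by simpa using ha⟩ : ∃ x ∈ M, x ≠ 1)
    obtain ⟨χ, hχ, -⟩ := exists_mem_IrrOver_ne_zero hM hx hx1
    exact hV χ hχ z (ne_zero_of_mem_center hχ.1 hz)
  · by_cases hx1 : x = 1
    · rw [hx1]; exact one_mem _
    · obtain ⟨χ, hχ, hne⟩ := exists_mem_IrrOver_ne_zero hM hx hx1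
      exact hV χ hχ x hne

theorem le_V {M : Subgroup G} (hM : M.Normal) : M ≤ V M := by
  by_cases h : M = ⊥
  · rw [h]; exact bot_le
  · exact le_sup_right.trans (center_sup_le_V hM h)

theorem le_commutator_of_V_ne_top {M : Subgroup G} (h : V M ≠ ⊤) : M ≤ commutator G := by
  intro x hx
  by_contra hxc
  have hx1 : (Abelianization.of x) ≠ 1 := fun h => hxc (by
    rwa [← MonoidHom.mem_ker, Abelianization.ker_of] at h)
  obtain ⟨φ, hφ⟩ := CommGroup.exists_apply_ne_one_of_hasEnoughRootsOfUnity
    (Abelianization G) ℂ hx1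
  let ψ : G →* ℂˣ := φ.comp Abelianization.of
  refine h (eq_top_iff.2 fun g _ => ?_)
  refine (le_iSup₂ (f := fun χ (_ : χ ∈ IrrOver M) => vanishingOff χ) (fun g => (ψ g : ℂ))
    ⟨linear_mem_Irr ψ, fun hk => hφ ?_⟩) (Subgroup.subset_closure (Units.ne_zero (ψ g)))
  have := hk hx
  simpa [charKer, ψ] using this

theorem U_le {N : Subgroup G} (hN : N ≠ ⊤) : U N ≤ N ⊓ commutator G := by
  refine sSup_le fun M ⟨hM, hV⟩ => le_inf ((le_V hM).trans hV) (le_commutator_of_V_ne_top ?_)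
  rintro h
  exact hN (top_le_iff.1 (h ▸ hV))

theorem I_le_U (N : Subgroup G) : I N ≤ U N :=
  sSup_le_sSup fun _ hM => ⟨hM.1, (V_le_C hM.1).trans hM.2⟩

end Average

end Characters

end FrobeniusTriple

/-! ### Normal p-complements, described by elements of order prime to p. -/

namespace FiniteGroup

open Subgroup

section PNilpotent

variable {G : Type*} [Group G]

/-- A subgroup of a finite group is `p`-nilpotent if its elements of order prime to `p` are closed
under multiplication; they form its normal `p`-complement. -/
def IsPNilpotent (p : ℕ) (X : Subgroup G) : Prop :=
  ∀ x ∈ X, ∀ y ∈ X, ¬ p ∣ orderOf x → ¬ p ∣ orderOf y → ¬ p ∣ orderOf (x * y)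

variable {p : ℕ}

theorem IsPNilpotent.mono {X Y : Subgroup G} (h : IsPNilpotent p Y) (hXY : X ≤ Y) :
    IsPNilpotent p X :=
  fun x hx y hy => h x (hXY hx) y (hXY hy)

theorem isPNilpotent_map_iff_of_injective {G' : Type*} [Group G'] {f : G →* G'}
    (hf : Function.Injective f) {X : Subgroup G} :
    IsPNilpotent p (X.map f) ↔ IsPNilpotent p X := by
  constructor
  · intro h x hx y hy hpx hpy
    rw [← orderOf_injective f hf] at hpx hpy ⊢
    rw [map_mul]
    exact h _ (mem_map_of_mem f hx) _ (mem_map_of_mem f hy) hpx hpy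
  · rintro h _ ⟨x, hx, rfl⟩ _ ⟨y, hy, rfl⟩ hpx hpy
    rw [orderOf_injective f hf] at hpx hpy
    rw [← map_mul, orderOf_injective f hf]
    exact h x hx y hy hpx hpy

theorem isPNilpotent_top_iff {X : Subgroup G} :
    IsPNilpotent p (⊤ : Subgroup X) ↔ IsPNilpotent p X := by
  rw [← isPNilpotent_map_iff_of_injective X.subtype_injective, ← MonoidHom.range_eq_map,
    X.range_subtype]

theorem not_dvd_orderOf_pow {x : G} (h : ¬ p ∣ orderOf x) (n : ℕ) :
    ¬ p ∣ orderOf (x ^ n) :=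
  fun h' => h (h'.trans (orderOf_pow_dvd n))

theorem not_dvd_orderOf_conj {x : G} (h : ¬ p ∣ orderOf x) (g : G) :
    ¬ p ∣ orderOf (g * x * g⁻¹) := by
  rwa [← MulAut.conj_apply, MulEquiv.orderOf_eq]

theorem not_dvd_orderOf_of_not_dvd_card {X : Subgroup G} (h : ¬ p ∣ Nat.card X) {x : G}
    (hx : x ∈ X) : ¬ p ∣ orderOf x :=
  fun h' => h (h'.trans (X.orderOf_dvd_natCard hx))

theorem IsPNilpotent.of_forall_mem {X W : Subgroup G} (hW : ¬ p ∣ Nat.card W)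
    (h : ∀ x ∈ X, ¬ p ∣ orderOf x → x ∈ W) : IsPNilpotent p X :=
  fun x hx y hy hpx hpy =>
    not_dvd_orderOf_of_not_dvd_card hW (W.mul_mem (h x hx hpx) (h y hy hpy))

variable [Fact p.Prime]

theorem eq_one_of_not_dvd_orderOf {X : Subgroup G} (hX : IsPGroup p X) {x : G} (hx : x ∈ X)
    (h : ¬ p ∣ orderOf x) : x = 1 := by
  by_contra h1
  refine h ?_
  rw [← orderOf_mk x hx]
  exact hX.dvd_orderOf (fun h => h1 (congrArg Subtype.val h))

theorem not_dvd_orderOf_one : ¬ p ∣ orderOf (1 : G) := by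
  rw [orderOf_one, Nat.dvd_one]
  exact (Fact.out : p.Prime).ne_one

theorem not_dvd_orderOf_of_map {G' : Type*} [Group G'] (f : G →* G') {X : Subgroup G}
    (hker : ∀ x ∈ X, f x = 1 → ¬ p ∣ orderOf x) {x : G} (hx : x ∈ X) (h : ¬ p ∣ orderOf (f x)) :
    ¬ p ∣ orderOf x := by
  intro h'
  have hz := hker (x ^ orderOf (f x)) (X.pow_mem hx _) (by rw [map_pow, pow_orderOf_eq_one])
  have : orderOf x ∣ orderOf (f x) * orderOf (x ^ orderOf (f x)) := by
    rw [orderOf_dvd_iff_pow_eq_one, pow_mul, pow_orderOf_eq_one]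
  exact ((Fact.out : p.Prime).dvd_mul.1 (h'.trans this)).elim h hz

theorem isPNilpotent_of_isPGroup {X : Subgroup G} (hX : IsPGroup p X) : IsPNilpotent p X := by
  intro x hx y hy hpx hpy
  rw [eq_one_of_not_dvd_orderOf hX hx hpx, eq_one_of_not_dvd_orderOf hX hy hpy, one_mul]
  exact not_dvd_orderOf_one

/-- The normal `p`-complement of a `p`-nilpotent subgroup. -/
def IsPNilpotent.complement {X : Subgroup G} (h : IsPNilpotent p X) : Subgroup G where
  carrier := {x | x ∈ X ∧ ¬ p ∣ orderOf x}
  one_mem' := ⟨X.one_mem, not_dvd_orderOf_one⟩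
  mul_mem' ha hb := ⟨X.mul_mem ha.1 hb.1, h _ ha.1 _ hb.1 ha.2 hb.2⟩
  inv_mem' ha := ⟨X.inv_mem ha.1, by rw [orderOf_inv]; exact ha.2⟩

theorem IsPNilpotent.complement_normal {X : Subgroup G} (h : IsPNilpotent p X) [hX : X.Normal] :
    h.complement.Normal :=
  ⟨fun x hx g => ⟨hX.conj_mem x hx.1 g, not_dvd_orderOf_conj hx.2 g⟩⟩

/-- In a `p`-nilpotent subgroup the normal `p`-complement centralizes every normal
`p`-subgroup. -/
theorem IsPNilpotent.commute {X H : Subgroup G} (h : IsPNilpotent p X) (hH : IsPGroup p H)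
    (hHX : H ≤ X) (hn : X ≤ normalizer H) {x y : G} (hx : x ∈ X) (hpx : ¬ p ∣ orderOf x)
    (hy : y ∈ H) : x * y = y * x := by
  -- The commutator is a product of two elements of order prime to `p`, and it lies in the `p`-group
  -- `H`.
  have h1 : x * (y * x⁻¹ * y⁻¹) = 1 := by
    refine eq_one_of_not_dvd_orderOf hH ?_ (h _ hx _ ?_ hpx (not_dvd_orderOf_conj ?_ y))
    · have := H.mul_mem ((mem_normalizer_iff.1 (hn hx) y).1 hy) (H.inv_mem hy)
      simpa [mul_assoc] using this
    · exact X.mul_mem (X.mul_mem (hHX hy) (X.inv_mem hx)) (X.inv_mem (hHX hy))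
    · rwa [orderOf_inv]
  calc x * y = x * (y * x⁻¹ * y⁻¹) * (y * x) := by group
    _ = y * x := by rw [h1, one_mul]

theorem IsPNilpotent.of_map {G' : Type*} [Group G'] {X : Subgroup G} (f : G →* G')
    (hker : ∀ x ∈ X, f x = 1 → ¬ p ∣ orderOf x) (h : IsPNilpotent p (X.map f)) :
    IsPNilpotent p X := by
  intro x hx y hy hpx hpy
  refine not_dvd_orderOf_of_map f hker (X.mul_mem hx hy) ?_
  rw [map_mul]
  exact h _ (mem_map_of_mem f hx) _ (mem_map_of_mem f hy)
    (fun h' => hpx (h'.trans (orderOf_map_dvd f _)))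
    (fun h' => hpy (h'.trans (orderOf_map_dvd f _)))

variable [Finite G]

theorem exists_not_dvd_orderOf_pow (p : ℕ) [hp : Fact p.Prime] (x : G) :
    ∃ k, ¬ p ∣ orderOf (x ^ p ^ k) := by
  obtain ⟨k, m, hm, h⟩ := Nat.exists_eq_pow_mul_and_not_dvd (orderOf_pos x).ne' p hp.out.ne_one
  refine ⟨k, ?_⟩
  rw [orderOf_pow_of_dvd (pow_ne_zero _ hp.out.ne_zero) ⟨m, h⟩, h,
    Nat.mul_div_cancel_left _ (pow_pos hp.out.pos _)]
  exact hm

theorem IsPNilpotent.map {G' : Type*} [Group G'] {X : Subgroup G} (h : IsPNilpotent p X)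
    (f : G →* G') : IsPNilpotent p (X.map f) := by
  -- The power `p ^ k` strips the `p`-part from `x`. Since `f x` has order prime to `p`, a further
  -- power `m` restores the image.
  have lift : ∀ x ∈ X, ¬ p ∣ orderOf (f x) → ∃ x' ∈ X, ¬ p ∣ orderOf x' ∧ f x' = f x := by
    intro x hx hpx
    obtain ⟨k, hk⟩ := exists_not_dvd_orderOf_pow p x
    obtain ⟨m, hm⟩ := exists_pow_eq_self_of_coprime (x := f x) (n := p ^ k)
      (((Nat.Prime.coprime_iff_not_dvd Fact.out).2 hpx).pow_left k)
    exact ⟨(x ^ p ^ k) ^ m, X.pow_mem (X.pow_mem hx _) _, not_dvd_orderOf_pow hk m, by simp [hm]⟩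
  rintro _ ⟨x, hx, rfl⟩ _ ⟨y, hy, rfl⟩ hpx hpy
  obtain ⟨x, hx, hpx, ex⟩ := lift x hx hpx
  obtain ⟨y, hy, hpy, ey⟩ := lift y hy hpy
  rw [← ex, ← ey, ← map_mul]
  exact fun h' => h x hx y hy hpx hpy (h'.trans (orderOf_map_dvd f _))

theorem IsPNilpotent.sup_of_normal {N Y : Subgroup G} [N.Normal]
    (hN : ∀ x ∈ N, ¬ p ∣ orderOf x) (hY : IsPNilpotent p Y) : IsPNilpotent p (N ⊔ Y) := by
  refine IsPNilpotent.of_map (QuotientGroup.mk' N) (fun x _ hx => hN x ?_) ?_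
  · simpa using hx
  · rw [Subgroup.map_sup, (map_eq_bot_iff N).2 (by simp), bot_sup_eq]
    exact hY.map _

theorem not_dvd_card_of_forall {X : Subgroup G} (h : ∀ x ∈ X, ¬ p ∣ orderOf x) :
    ¬ p ∣ Nat.card X := by
  intro hd
  obtain ⟨x, hx⟩ := exists_prime_orderOf_dvd_card' p hd
  exact h x x.2 (by rw [Subgroup.orderOf_coe, hx])

theorem IsPNilpotent.not_dvd_card_complement {X : Subgroup G} (h : IsPNilpotent p X) :
    ¬ p ∣ Nat.card h.complement :=
  not_dvd_card_of_forall fun _ hx => hx.2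

/-- Modulo the complement `X` is a `p`-group, so the index of the join is a power of `p` that
divides a number prime to `p`. -/
theorem IsPNilpotent.le_complement_sup {X S : Subgroup G} (h : IsPNilpotent p X)
    (hi : ¬ p ∣ S.relIndex X) : X ≤ h.complement ⊔ S := by
  have hn : (h.complement.subgroupOf X).Normal :=
    ⟨fun x hx g => ⟨X.mul_mem (X.mul_mem g.2 x.2) (X.inv_mem g.2), not_dvd_orderOf_conj hx.2 g⟩⟩
  have hq : IsPGroup p (X ⧸ h.complement.subgroupOf X) := by
    intro y
    obtain ⟨x, rfl⟩ := QuotientGroup.mk_surjective y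
    obtain ⟨k, hk⟩ := exists_not_dvd_orderOf_pow p (x : G)
    refine ⟨k, ?_⟩
    rw [← QuotientGroup.mk_pow, QuotientGroup.eq_one_iff]
    exact ⟨(x ^ p ^ k).2, hk⟩
  obtain ⟨n, hn⟩ := (IsPGroup.iff_card).1 hq
  have h1 : (h.complement ⊔ S).relIndex X ∣ p ^ n := by
    rw [← hn]
    exact relIndex_dvd_of_le_left X le_sup_left
  have h2 : (h.complement ⊔ S).relIndex X ∣ S.relIndex X := relIndex_dvd_of_le_left X le_sup_right
  rw [← relIndex_eq_one]
  obtain ⟨m, -, hm⟩ := (Nat.dvd_prime_pow Fact.out).1 h1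
  rw [hm] at h2 ⊢
  rcases m.eq_zero_or_pos with rfl | hm0
  · rfl
  · exact absurd ((dvd_pow_self p hm0.ne').trans h2) hi

/-- Burnside's argument: the transfer into `P` kills all elements of order prime to `p`, and its
kernel has order prime to `p`. -/
theorem isPNilpotent_top_of_le_center (P : Sylow p G) (h : (P : Subgroup G) ≤ center G) :
    IsPNilpotent p (⊤ : Subgroup G) := by
  have hP : normalizer P ≤ centralizer (P : Set G) := fun x _ =>
    mem_centralizer_iff.2 fun y hy => (mem_center_iff.1 (h hy) x).symm
  refine IsPNilpotent.of_forall_mem (MonoidHom.not_dvd_card_ker_transferSylow P hP)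
    fun x _ hx => ?_
  have h1 : ((MonoidHom.transferSylow P hP x : P) : G) = 1 :=
    eq_one_of_not_dvd_orderOf P.2 (Subtype.mem _) fun h' => hx <| by
      rw [Subgroup.orderOf_coe] at h'
      exact h'.trans (orderOf_map_dvd _ _)
  exact Subtype.ext h1

theorem isPNilpotent_of_central {X Z : Subgroup G} (hZ : IsPGroup p Z)
    (hc : ∀ x ∈ X, ∀ z ∈ Z, x * z = z * x) (hi : ¬ p ∣ Z.relIndex X) : IsPNilpotent p X := by
  rw [← isPNilpotent_top_iff]
  have hZ' : IsPGroup p (Z.subgroupOf X) := hZ.comap_subtype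
  refine isPNilpotent_top_of_le_center (hZ'.toSylow hi) fun z hz => ?_
  exact mem_center_iff.2 fun x => Subtype.ext (hc x x.2 z hz)

/-- A finite group with a normal Sylow `p`-subgroup that is centralized by a Sylow `r`-subgroup for
every prime `r ≠ p` is `p`-nilpotent. -/
theorem isPNilpotent_top_of_forall_sylow (P : Sylow p G) [hPn : P.Normal]
    (h : ∀ r, Fact r.Prime → r ≠ p →
      ∃ R : Sylow r G, (R : Subgroup G) ≤ centralizer (P : Set G)) :
    IsPNilpotent p (⊤ : Subgroup G) := by
  have hC : (centralizer ((P : Subgroup G) : Set G)).Normal := inferInstance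
  set C := centralizer ((P : Subgroup G) : Set G) with hCdef
  -- `C` contains a Sylow `r`-subgroup for each `r ≠ p`, so only `p` can divide its index. In `C`
  -- the Sylow subgroup `P ⊓ C` is central.
  have hmem : ∀ x : G, ¬ p ∣ orderOf x → x ∈ C := by
    intro x hx
    rw [← QuotientGroup.eq_one_iff, ← orderOf_eq_one_iff]
    by_contra h1
    obtain ⟨r, hr, hrd⟩ := Nat.exists_prime_and_dvd h1
    have hr' : Fact r.Prime := ⟨hr⟩
    have hrp : r ≠ p := by
      rintro rfl
      exact hx (hrd.trans (orderOf_map_dvd (QuotientGroup.mk' C) x))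
    obtain ⟨R, hR⟩ := h r hr' hrp
    refine R.not_dvd_index (hrd.trans ((_root_.orderOf_dvd_natCard _).trans (index_dvd_of_le hR)))
  have hCp : IsPNilpotent p C := by
    refine isPNilpotent_of_central (Z := (P : Subgroup G) ⊓ C) (P.2.to_le inf_le_left)
      (fun x hx z hz => (mem_centralizer_iff.1 hx z hz.1).symm) fun hd => ?_
    rw [inf_relIndex_right] at hd
    exact P.not_dvd_index (hd.trans (relIndex_dvd_index_of_normal _ _))
  exact fun x _ y _ hpx hpy => hCp x (hmem x hpx) y (hmem y hpy) hpx hpy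

theorem isPNilpotent_top_of_isNilpotent (p : ℕ) [Fact p.Prime] [Group.IsNilpotent G] :
    IsPNilpotent p (⊤ : Subgroup G) := by
  refine isPNilpotent_top_of_forall_sylow (default : Sylow p G) fun r _ hr => ⟨default, ?_⟩
  intro x hx
  refine mem_centralizer_iff.2 fun y hy => ?_
  exact (Subgroup.commute_of_normal_of_disjoint _ _ inferInstance inferInstance
    (IsPGroup.disjoint_of_ne p r hr.symm _ _ (default : Sylow p G).2 (default : Sylow r G).2)
    y x hy hx)

end PNilpotent

end FiniteGroup

/-! ### Fusion and Frobenius' normal p-complement theorem. -/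

namespace FiniteGroup

open Subgroup

open scoped commutatorElement

section Fusion

variable {G : Type*} [Group G] {p : ℕ} [Fact p.Prime] [Finite G]

theorem lt_inf_normalizer {D P : Subgroup G} (hP : IsPGroup p P) (h : D < P) :
    D < P ⊓ normalizer D := by
  have hnil : Group.IsNilpotent P := hP.isNilpotent
  have hlt : D.subgroupOf P < ⊤ := lt_top_iff_ne_top.2 fun h' =>
    h.not_ge (subgroupOf_eq_top.1 h')
  have := Group.normalizerCondition_of_isNilpotent _ hlt
  have h2 := map_subtype_lt_map_subtype.2 this
  rw [subgroupOf_map_subtype, inf_of_le_left h.le] at h2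
  refine h2.trans_le ?_
  rintro _ ⟨x, hx, rfl⟩
  refine ⟨x.2, mem_normalizer_iff.2 fun y => ?_⟩
  have hx := mem_normalizer_iff.1 hx
  constructor
  · intro hy
    exact (hx ⟨y, h.le hy⟩).1 hy
  · intro hy
    have hyP : y ∈ P := by
      have := P.mul_mem (P.mul_mem (P.inv_mem x.2) (h.le hy)) x.2
      simpa [mul_assoc] using this
    exact (hx ⟨y, hyP⟩).2 hy

/-- Iteration puts `Q` into every term of the lower central series of the nilpotent group `P`. -/
theorem eq_bot_of_le_commutator {Q P : Subgroup G} (hP : IsPGroup p P) (hQP : Q ≤ P)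
    (h : Q ≤ ⁅Q, P⁆) : Q = ⊥ := by
  have hnil : Group.IsNilpotent P := hP.isNilpotent
  obtain ⟨n, hn⟩ := (isNilpotent_iff_lowerCentralSeries P).1 hnil
  have hle : ∀ n, Q ≤ P.lowerCentralSeries n := by
    intro n
    induction n with
    | zero => exact hQP
    | succ n ih => exact h.trans (commutator_mono ih le_rfl)
  exact le_bot_iff.1 (hn ▸ hle n)

/-- If the normalizers of the nontrivial `p`-subgroups are `p`-nilpotent, then two Sylow
`p`-subgroups are conjugate under the centralizer of their intersection. -/
theorem exists_mem_centralizer_smul_eq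
    (h : ∀ D : Subgroup G, D ≠ ⊥ → IsPGroup p D → IsPNilpotent p (normalizer (D : Set G)))
    (n : ℕ) : ∀ P S : Sylow p G, Nat.card G - Nat.card (P ⊓ S : Subgroup G) = n →
    ∃ c ∈ centralizer ((P ⊓ S : Subgroup G) : Set G), c • S = P := by
  induction n using Nat.strong_induction_on with
  | _ n ih =>
  intro P S hn
  set D : Subgroup G := P ⊓ S with hD
  have hDp : IsPGroup p D := P.2.to_le inf_le_left
  by_cases hD1 : D = ⊥
  · obtain ⟨c, hc⟩ := MulAction.exists_smul_eq G S P
    refine ⟨c, mem_centralizer_iff.2 fun y hy => ?_, hc⟩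
    rw [hD1] at hy
    rw [mem_bot.1 hy, one_mul, mul_one]
  by_cases hPS : P = S
  · exact ⟨1, one_mem _, by rw [one_smul, hPS]⟩
  have hDP : D < P := inf_lt_left.2 fun hle => hPS (Sylow.ext (P.3 S.2 hle).symm)
  have hDS : D < S := inf_lt_right.2 fun hle => hPS (Sylow.ext (S.3 P.2 hle))
  have ih' : ∀ P' S' : Sylow p G, D < (P' ⊓ S' : Subgroup G) →
      ∃ c ∈ centralizer (D : Set G), c • S' = P' := by
    intro P' S' hlt
    have hcard : Nat.card D < Nat.card (P' ⊓ S' : Subgroup G) :=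
      Set.ncard_lt_ncard (SetLike.coe_ssubset_coe.2 hlt) (Set.toFinite _)
    have hle : Nat.card (P' ⊓ S' : Subgroup G) ≤ Nat.card G := Subgroup.card_le_card_group _
    obtain ⟨c, hc, hcs⟩ := ih _ (by omega) P' S' rfl
    exact ⟨c, centralizer_le (SetLike.coe_subset_coe.2 hlt.le) hc, hcs⟩
  set N := normalizer (D : Set G) with hNdef
  have hDN : D ≤ N := le_normalizer
  have hN : IsPNilpotent p (⊤ : Subgroup N) := isPNilpotent_top_iff.2 (h D hD1 hDp)
  obtain ⟨T, hT⟩ := ((P.2.to_le inf_le_left : IsPGroup p (P ⊓ N : Subgroup G)).comap_subtype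
    (K := N)).exists_le_sylow
  obtain ⟨U, hU⟩ := ((S.2.to_le inf_le_left : IsPGroup p (S ⊓ N : Subgroup G)).comap_subtype
    (K := N)).exists_le_sylow
  -- Sylow subgroups of the `p`-nilpotent group `N` are conjugate already under its normal
  -- complement, which centralizes `D`.
  obtain ⟨k, hkp, hkU⟩ : ∃ k : N, ¬ p ∣ orderOf k ∧ k • T = U := by
    obtain ⟨m, hm⟩ := MulAction.exists_smul_eq N T U
    have hcn := hN.complement_normal
    have hmem : m ∈ hN.complement ⊔ (T : Subgroup N) :=
      hN.le_complement_sup (by rw [relIndex_top_right]; exact T.not_dvd_index) (mem_top m)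
    obtain ⟨k, hk, t, ht, rfl⟩ := mem_sup_of_normal_left.1 hmem
    refine ⟨k, hk.2, ?_⟩
    rw [mul_smul, Sylow.smul_eq_iff_mem_normalizer.2 (le_normalizer ht)] at hm
    exact hm
  have hkD : (k : G) ∈ centralizer (D : Set G) := mem_centralizer_iff.2 fun y hy =>
    ((h D hD1 hDp).commute hDp hDN le_rfl k.2 (by rwa [Subgroup.orderOf_coe]) hy).symm
  -- `R` interpolates between `P` and `S`: since normalizers grow in `p`-groups, `P ⊓ R` and `k • R
  -- ⊓ S` are strictly larger than `D`, and the induction covers larger intersections.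
  obtain ⟨R, hR⟩ := (T.2.map N.subtype).exists_le_sylow
  have hPR : D < (P ⊓ R : Subgroup G) := by
    refine (lt_inf_normalizer P.2 hDP).trans_le (le_inf inf_le_left fun x hx => ?_)
    exact hR ⟨⟨x, hx.2⟩, hT hx, rfl⟩
  have hRS : D < (((k : G) • R : Sylow p G) ⊓ S : Subgroup G) := by
    refine (lt_inf_normalizer S.2 hDS).trans_le (le_inf (fun x hx => ?_) inf_le_left)
    have hxU : (⟨x, hx.2⟩ : N) ∈ U := hU hx
    rw [← hkU] at hxU
    obtain ⟨t, ht, htx⟩ := hxU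
    exact ⟨t, hR ⟨t, ht, rfl⟩, congrArg Subtype.val htx⟩
  obtain ⟨c₁, hc₁, h₁⟩ := ih' P R hPR
  obtain ⟨c₂, hc₂, h₂⟩ := ih' ((k : G) • R) S hRS
  refine ⟨c₁ * (k : G)⁻¹ * c₂, mul_mem (mul_mem hc₁ (inv_mem hkD)) hc₂, ?_⟩
  rw [mul_smul, mul_smul, h₂, inv_smul_smul, h₁]

/-- `P` controls its own fusion. The preceding theorem for `P` and `g⁻¹ • P` gives `g = kuc`, where
`c` centralizes `x`, `u ∈ P`, and `k`, from the normal complement of the normalizer of `P`,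
centralizes `P`. -/
theorem exists_mem_conj_eq_of_conj_mem
    (h : ∀ D : Subgroup G, D ≠ ⊥ → IsPGroup p D → IsPNilpotent p (normalizer (D : Set G)))
    (P : Sylow p G) {x g : G} (hx : x ∈ P) (hg : g * x * g⁻¹ ∈ P) :
    ∃ u ∈ P, u * x * u⁻¹ = g * x * g⁻¹ := by
  by_cases hP : (P : Subgroup G) = ⊥
  · have hx1 : x = 1 := by
      have : x ∈ (P : Subgroup G) := hx
      rwa [hP, mem_bot] at this
    exact ⟨1, one_mem P, by simp [hx1]⟩
  obtain ⟨c, hc, hcS⟩ := exists_mem_centralizer_smul_eq h _ P (g⁻¹ • P) rfl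
  have hxS : x ∈ ((g⁻¹ • P : Sylow p G) : Subgroup G) :=
    ⟨g * x * g⁻¹, hg, by simp [mul_assoc]⟩
  have hcx : x * c = c * x := mem_centralizer_iff.1 hc x ⟨hx, hxS⟩
  rw [← mul_smul, Sylow.smul_eq_iff_mem_normalizer] at hcS
  set N := normalizer ((P : Subgroup G) : Set G)
  have hN := h P hP P.2
  have hN' : IsPNilpotent p (⊤ : Subgroup N) := isPNilpotent_top_iff.2 hN
  have hcn := hN'.complement_normal
  have hPN : (P : Subgroup G) ≤ N := le_normalizer
  have hgN : g * c⁻¹ ∈ N := by simpa using N.inv_mem hcS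
  have hmem : (⟨g * c⁻¹, hgN⟩ : N) ∈ hN'.complement ⊔ (P : Subgroup G).subgroupOf N :=
    hN'.le_complement_sup (by
      rw [relIndex_top_right]
      exact fun hd => P.not_dvd_index (hd.trans (relIndex_dvd_index_of_le hPN))) (mem_top _)
  obtain ⟨k, hk, u, hu, hku⟩ := mem_sup_of_normal_left.1 hmem
  have hu' : (u : G) ∈ (P : Subgroup G) := hu
  refine ⟨u, hu', ?_⟩
  have hgc : g = k * u * c := by
    rw [← coe_mul, hku]; simp
  have hkx := hN.commute P.2 hPN le_rfl k.2 (by rw [Subgroup.orderOf_coe]; exact hk.2)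
    (P.mul_mem (P.mul_mem hu' hx) (P.inv_mem hu'))
  calc (u : G) * x * (u : G)⁻¹ = k * (u * x * (u : G)⁻¹) * (k : G)⁻¹ := by rw [hkx]; group
    _ = k * u * (x * c) * c⁻¹ * (u : G)⁻¹ * (k : G)⁻¹ := by group
    _ = g * x * g⁻¹ := by rw [hcx, hgc]; group

/-- **Frobenius' normal `p`-complement theorem**. -/
theorem isPNilpotent_top_of_forall_normalizer
    (h : ∀ D : Subgroup G, D ≠ ⊥ → IsPGroup p D → IsPNilpotent p (normalizer (D : Set G))) :
    IsPNilpotent p (⊤ : Subgroup G) := by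
  set A : Subgroup G := closure {x | ¬ p ∣ orderOf x} with hA
  refine IsPNilpotent.of_forall_mem (W := A) ?_ fun x _ hx => subset_closure hx
  let Q : Sylow p A := default
  obtain ⟨P, hP⟩ := Sylow.exists_comap_subtype_eq Q
  have hQ : ∀ x : A, x ∈ Q ↔ (x : G) ∈ P := fun x => by
    exact (SetLike.ext_iff.1 hP x).symm
  -- The target is a `p`-group, so the generators of `A` are killed.
  have htriv : (Q : Subgroup A).transferFocal = 1 := by
    have hle : A ≤ ((Q : Subgroup A).transferFocal.ker).map A.subtype := by
      refine (closure_le _).2 fun x hx => ?_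
      refine ⟨⟨x, subset_closure hx⟩, ?_, rfl⟩
      rw [SetLike.mem_coe, MonoidHom.mem_ker]
      have hq : IsPGroup p (Q ⧸ (Q : Subgroup A).focalSubgroupOf) := Q.2.to_quotient _
      by_contra h1
      refine hx ((hq.dvd_orderOf h1).trans ((orderOf_map_dvd _ _).trans ?_))
      rw [Subgroup.orderOf_mk]
    ext x
    obtain ⟨y, hy, hyx⟩ := hle x.2
    rw [← show y = x from Subtype.ext hyx]
    exact hy
  have hfoc : (Q : Subgroup A) ≤ (Q : Subgroup A).focalSubgroup := by
    rw [← ker_transferFocal_inf_eq_focalSubgroup, htriv]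
    intro x hx
    exact ⟨rfl, hx⟩
  -- `Q` equals its focal subgroup, generated by commutators `⁅x, u⁆` with `u ∈ A`. By control of
  -- fusion in `G`, each `u` can be replaced by some `v ∈ P`, so `Q ≤ ⁅Q, P⁆`.
  have hQ' : ((Q : Subgroup A).map A.subtype) = ⊥ := by
    refine eq_bot_of_le_commutator P.2 ?_ ?_
    · rintro _ ⟨x, hx, rfl⟩
      exact (hQ x).1 hx
    · refine (map_mono hfoc).trans ?_
      rw [map_le_iff_le_comap, focalSubgroup_def, closure_le]
      rintro _ ⟨hmem, x, hx, u, rfl⟩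
      rw [SetLike.mem_coe, mem_comap]
      have hxP := (hQ x).1 hx
      have huxP : (u : G) * (x : G)⁻¹ * (u : G)⁻¹ ∈ P := by
        have := P.mul_mem (P.inv_mem hxP) ((hQ _).1 hmem)
        simpa [commutatorElement_def, mul_assoc] using! this
      obtain ⟨v, hv, hvx⟩ := exists_mem_conj_eq_of_conj_mem h P (P.inv_mem hxP) huxP
      have : A.subtype ⁅x, u⁆ = ⁅(x : G), v⁆ := by
        rw [map_commutatorElement, commutatorElement_def, commutatorElement_def]
        simp only [coe_subtype, mul_assoc] at hvx ⊢
        rw [hvx]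
      rw [this]
      exact commutator_mem_commutator ⟨x, hx, rfl⟩ hv
  have hQbot : (Q : Subgroup A) = ⊥ := (map_eq_bot_iff_of_injective _ A.subtype_injective).1 hQ'
  intro hd
  exact Q.ne_bot_of_dvd_card hd hQbot

end Fusion

end FiniteGroup

/-! ### The Thompson subgroup and replacement. -/

namespace FiniteGroup

open Subgroup

section Thompson

variable {G : Type*} [Group G]

theorem mem_sup_of_le_normalizer {H N : Subgroup G} (h : H ≤ normalizer (N : Set G)) {x : G} :
    x ∈ H ⊔ N ↔ ∃ a ∈ H, ∃ b ∈ N, a * b = x := by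
  rw [← SetLike.mem_coe, coe_mul_of_left_le_normalizer_right H N h, Set.mem_mul]
  rfl

theorem relIndex_sup_of_le_normalizer {H N : Subgroup G} (h : H ≤ normalizer (N : Set G)) :
    N.relIndex (H ⊔ N) = N.relIndex H :=
  have := normal_subgroupOf_of_le_normalizer h
  have := normal_subgroupOf_sup_of_le_normalizer h
  (Nat.card_congr (QuotientGroup.quotientInfEquivProdNormalizerQuotient H N h).toEquiv).symm

theorem card_mul_relIndex {H K : Subgroup G} (h : H ≤ K) :
    Nat.card H * H.relIndex K = Nat.card K := by
  rw [← relIndex_bot_left, ← relIndex_bot_left, relIndex_mul_relIndex _ _ _ bot_le h]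

theorem card_sup_mul_card_inf {H N : Subgroup G} (h : H ≤ normalizer (N : Set G)) :
    Nat.card (H ⊔ N : Subgroup G) * Nat.card (H ⊓ N : Subgroup G) = Nat.card H * Nat.card N := by
  rw [← card_mul_relIndex (le_sup_right : N ≤ H ⊔ N), relIndex_sup_of_le_normalizer h,
    ← inf_relIndex_left, mul_right_comm, ← card_mul_relIndex (inf_le_left : H ⊓ N ≤ H)]
  ring

/-- `A` is an abelian subgroup of `S` of the largest possible order. -/
structure IsMaxAbelian (S A : Subgroup G) : Prop where
  le : A ≤ S
  comm : A ≤ centralizer (A : Set G)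
  card_le : ∀ B ≤ S, B ≤ centralizer (B : Set G) → Nat.card B ≤ Nat.card A

/-- The Thompson subgroup: the join of the abelian subgroups of largest order. -/
def thompsonSubgroup (S : Subgroup G) : Subgroup G :=
  sSup {A | IsMaxAbelian S A}

/-- The center of a subgroup, as a subgroup of the ambient group. -/
def centerIn (S : Subgroup G) : Subgroup G :=
  S ⊓ centralizer (S : Set G)

theorem thompsonSubgroup_le (S : Subgroup G) : thompsonSubgroup S ≤ S :=
  sSup_le fun _ hA => hA.le

theorem map_centralizer_of_injective {G' : Type*} [Group G'] {f : G →* G'}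
    (hf : Function.Injective f) {X Y : Subgroup G} :
    Y.map f ≤ centralizer (X.map f : Set G') ↔ Y ≤ centralizer (X : Set G) := by
  constructor
  · intro h y hy
    refine mem_centralizer_iff.2 fun x hx => hf ?_
    rw [map_mul, map_mul]
    exact mem_centralizer_iff.1 (h (mem_map_of_mem f hy)) _ (mem_map_of_mem f hx)
  · rintro h _ ⟨y, hy, rfl⟩
    refine mem_centralizer_iff.2 ?_
    rintro _ ⟨x, hx, rfl⟩
    rw [← map_mul, ← map_mul, mem_centralizer_iff.1 (h hy) x hx]

/-- The generality of all injective homomorphisms serves conjugations, automorphisms and inclusions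
of subgroups alike. -/
theorem centerIn_map {G' : Type*} [Group G'] {f : G →* G'} (hf : Function.Injective f)
    (S : Subgroup G) : centerIn (S.map f) = (centerIn S).map f := by
  ext z
  constructor
  · rintro ⟨⟨z, hz, rfl⟩, hc⟩
    refine ⟨z, ⟨hz, mem_centralizer_iff.2 fun x hx => hf ?_⟩, rfl⟩
    rw [map_mul, map_mul]
    exact mem_centralizer_iff.1 hc _ (mem_map_of_mem f hx)
  · rintro ⟨z, ⟨hz, hc⟩, rfl⟩
    refine ⟨mem_map_of_mem f hz, mem_centralizer_iff.2 ?_⟩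
    rintro _ ⟨x, hx, rfl⟩
    rw [← map_mul, ← map_mul, mem_centralizer_iff.1 hc x hx]

theorem exists_map_eq_of_le_map {G' : Type*} [Group G'] {f : G →* G'} (hf : Function.Injective f)
    {S : Subgroup G} {B : Subgroup G'} (h : B ≤ S.map f) : ∃ B' ≤ S, B'.map f = B := by
  have hB : (B.comap f).map f = B := map_comap_eq_self (h.trans (map_le_range f S))
  exact ⟨B.comap f, (map_le_map_iff_of_injective hf).1 (hB.le.trans h), hB⟩

theorem isMaxAbelian_map_iff {G' : Type*} [Group G'] {f : G →* G'} (hf : Function.Injective f)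
    {S A : Subgroup G} : IsMaxAbelian (S.map f) (A.map f) ↔ IsMaxAbelian S A := by
  have hcard : ∀ X : Subgroup G, Nat.card (X.map f) = Nat.card X := fun X =>
    card_map_of_injective hf
  constructor
  · rintro ⟨h1, h2, h3⟩
    refine ⟨(map_le_map_iff_of_injective hf).1 h1, (map_centralizer_of_injective hf).1 h2,
      fun B hB hBc => ?_⟩
    have := h3 (B.map f) (map_mono hB) ((map_centralizer_of_injective hf).2 hBc)
    rwa [hcard, hcard] at this
  · rintro ⟨h1, h2, h3⟩
    refine ⟨map_mono h1, (map_centralizer_of_injective hf).2 h2, fun B hB hBc => ?_⟩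
    obtain ⟨B, hBS, rfl⟩ := exists_map_eq_of_le_map hf hB
    rw [hcard, hcard]
    exact h3 B hBS ((map_centralizer_of_injective hf).1 hBc)

theorem thompsonSubgroup_map {G' : Type*} [Group G'] {f : G →* G'} (hf : Function.Injective f)
    (S : Subgroup G) : thompsonSubgroup (S.map f) = (thompsonSubgroup S).map f := by
  refine le_antisymm (sSup_le fun A hA => ?_) ?_
  · obtain ⟨A, -, rfl⟩ := exists_map_eq_of_le_map hf hA.le
    exact map_mono (le_sSup ((isMaxAbelian_map_iff hf).1 hA))
  · rw [map_le_iff_le_comap]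
    exact sSup_le fun A hA => map_le_iff_le_comap.1 (le_sSup ((isMaxAbelian_map_iff hf).2 hA))

theorem normalizer_le_normalizer_of_map {Φ : Subgroup G → Subgroup G}
    (hΦ : ∀ (f : G →* G) (_ : Function.Injective f) (S : Subgroup G), Φ (S.map f) = (Φ S).map f)
    (S : Subgroup G) : normalizer (S : Set G) ≤ normalizer (Φ S : Set G) := by
  intro g hg
  rw [mem_normalizer_iff_map_conj_eq] at hg ⊢
  rw [← hΦ _ (MulAut.conj g).injective, hg]

theorem normalizer_le_normalizer_centerIn (S : Subgroup G) :
    normalizer (S : Set G) ≤ normalizer (centerIn S : Set G) :=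
  normalizer_le_normalizer_of_map (fun _ hf S => centerIn_map hf S) S

theorem normalizer_le_normalizer_thompsonSubgroup (S : Subgroup G) :
    normalizer (S : Set G) ≤ normalizer (thompsonSubgroup S : Set G) :=
  normalizer_le_normalizer_of_map (fun _ hf S => thompsonSubgroup_map hf S) S

variable [Finite G]

theorem exists_isMaxAbelian (S : Subgroup G) : ∃ A, IsMaxAbelian S A := by
  obtain ⟨A, ⟨hAS, hA⟩, hmax⟩ := Set.exists_max_image
    {B : Subgroup G | B ≤ S ∧ B ≤ centralizer (B : Set G)} (fun B => Nat.card B) (Set.toFinite _)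
    ⟨⊥, bot_le, bot_le⟩
  exact ⟨A, hAS, hA, fun B hBS hB => hmax B ⟨hBS, hB⟩⟩

theorem thompsonSubgroup_eq_of_forall_le {S H : Subgroup G} (hHS : H ≤ S)
    (h : ∀ A, IsMaxAbelian S A → A ≤ H) : thompsonSubgroup S = thompsonSubgroup H := by
  obtain ⟨A₀, hA₀⟩ := exists_isMaxAbelian S
  have : ∀ A, IsMaxAbelian S A ↔ IsMaxAbelian H A := by
    refine fun A => ⟨fun hA => ⟨h A hA, hA.comm, fun B hB => hA.card_le B (hB.trans hHS)⟩,
      fun hA => ⟨hA.le.trans hHS, hA.comm, fun B hB hBc => ?_⟩⟩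
    exact (hA₀.card_le B hB hBc).trans (hA.card_le A₀ (h A₀ hA₀) hA₀.comm)
  simp only [thompsonSubgroup, this]

theorem thompsonSubgroup_ne_bot {S : Subgroup G} (hS : S ≠ ⊥) : thompsonSubgroup S ≠ ⊥ := by
  obtain ⟨⟨x, hxS⟩, hx⟩ := ne_bot_iff_exists_ne_one.1 hS
  obtain ⟨A, hA⟩ := exists_isMaxAbelian S
  intro h
  have hA1 : A = ⊥ := le_bot_iff.1 (h ▸ le_sSup hA)
  have hc := hA.card_le (zpowers x) (zpowers_le.2 hxS)
    (le_centralizer_iff_isMulCommutative.2 inferInstance)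
  rw [hA1, card_bot, Nat.card_zpowers] at hc
  have : orderOf x = 1 := le_antisymm hc (orderOf_pos x)
  exact hx (Subtype.ext (orderOf_eq_one_iff.1 this))

theorem centerIn_ne_bot {p : ℕ} [Fact p.Prime] {S : Subgroup G} (hp : IsPGroup p S) (hS : S ≠ ⊥) :
    centerIn S ≠ ⊥ := by
  have : Nontrivial S := S.nontrivial_iff_ne_bot.2 hS
  obtain ⟨⟨z, hz⟩, hz1⟩ := ne_bot_iff_exists_ne_one.1 (hp.bot_lt_center.ne')
  refine ne_bot_iff_exists_ne_one.2 ⟨⟨z, z.2, mem_centralizer_iff.2 fun x hx => ?_⟩, fun h => ?_⟩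
  · exact congrArg Subtype.val (mem_center_iff.1 hz ⟨x, hx⟩)
  · have h' : (z : G) = 1 := congrArg Subtype.val h
    exact hz1 (Subtype.ext (Subtype.ext h'))

/-- **Thompson's replacement theorem**. -/
theorem IsMaxAbelian.exists_replacement {p : ℕ} [Fact p.Prime] {S A B : Subgroup G}
    (hS : IsPGroup p S) (hA : IsMaxAbelian S A) (hBS : B ≤ S) (hB : B ≤ centralizer (B : Set G))
    (hAB : A ≤ normalizer (B : Set G)) (hBA : ¬ B ≤ normalizer (A : Set G)) :
    ∃ A', IsMaxAbelian S A' ∧ A ⊓ B < A' ⊓ B ∧ A' ≤ normalizer (A : Set G) := by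
  -- Let `N = B ⊓ N(A)`. As normalizers grow in `p`-groups, some element of `AB` outside `AN`
  -- normalizes `AN`; its factor in `B` is `b`. The conjugates of `A` by `b` and `b⁻¹` stay in `AN`,
  -- hence normalize `A`.
  obtain ⟨b, hbB, hbA, hconj⟩ : ∃ b ∈ B, b ∉ normalizer (A : Set G) ∧
      ∀ a ∈ A, b * a * b⁻¹ ∈ normalizer (A : Set G) ∧ b⁻¹ * a * b ∈ normalizer (A : Set G) := by
    set N := B ⊓ normalizer (A : Set G)
    have hNA : N ⊔ A ≤ normalizer (A : Set G) := sup_le inf_le_right le_normalizer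
    have hlt : A ⊔ N < A ⊔ B := by
      refine lt_of_le_of_ne (sup_le_sup_left inf_le_left A) fun h => hBA ?_
      rw [sup_comm] at h
      exact (le_sup_right.trans h.ge).trans hNA
    have hlt' := lt_inf_normalizer (hS.to_le (sup_le hA.le hBS)) hlt
    obtain ⟨g, hg, hgN⟩ := SetLike.exists_of_lt hlt'
    obtain ⟨a, ha, b, hb, rfl⟩ := (mem_sup_of_le_normalizer hAB).1 hg.1
    have haAN : a ∈ A ⊔ N := mem_sup_left ha
    have hbn : b ∈ normalizer ((A ⊔ N : Subgroup G) : Set G) :=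
      (mul_mem_cancel_left (le_normalizer haAN)).1 hg.2
    have hle : A ⊔ N ≤ normalizer (A : Set G) := by rw [sup_comm]; exact hNA
    refine ⟨b, hb, fun hbA => hgN ?_, fun a' ha' => ⟨?_, ?_⟩⟩
    · exact mul_mem haAN (mem_sup_right ⟨hb, hbA⟩)
    · exact hle ((mem_normalizer_iff.1 hbn a').1 (mem_sup_left ha'))
    · exact hle ((mem_normalizer_iff''.1 hbn a').1 (mem_sup_left ha'))
  set A₁ : Subgroup G := A.map (MulAut.conj b).toMonoidHom with hA₁
  have hmem₁ : ∀ x, x ∈ A₁ ↔ b⁻¹ * x * b ∈ A := by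
    intro x
    constructor
    · rintro ⟨a, ha, rfl⟩
      simpa [mul_assoc] using ha
    · intro h
      exact ⟨_, h, by simp [mul_assoc]⟩
  have hA₁A : A₁ ≤ normalizer (A : Set G) := by
    rintro _ ⟨a, ha, rfl⟩
    exact (hconj a ha).1
  have hAA₁ : A ≤ normalizer (A₁ : Set G) := by
    refine le_normalizer_iff.2 fun a ha x hx => ?_
    rw [hmem₁] at hx ⊢
    have := (mem_normalizer_iff.1 (hconj a ha).2 _).1 hx
    simpa [mul_assoc] using this
  have hA₁c : A₁ ≤ centralizer (A₁ : Set G) :=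
    (map_centralizer_of_injective (MulAut.conj b).injective).2 hA.comm
  have hcard₁ : Nat.card A₁ = Nat.card A := card_map_of_injective (MulAut.conj b).injective
  -- The replacement is `MD`: `D` is central in `E`, and `M` is abelian as a subgroup of `B`. From
  -- `E = MA` and `M ⊓ A = M ⊓ D`, counting gives `|MD| = |E||D|/|A| = |A|`.
  set D := A ⊓ A₁
  set E := A ⊔ A₁
  set M := E ⊓ B
  have hEA : E ≤ normalizer (A : Set G) := sup_le le_normalizer hA₁A
  have hDE : E ≤ centralizer (D : Set G) :=
    sup_le (hA.comm.trans (centralizer_le inf_le_left))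
      (hA₁c.trans (centralizer_le inf_le_right))
  have hDle : D ≤ E := inf_le_left.trans le_sup_left
  have hMc : M ≤ centralizer (M : Set G) :=
    (inf_le_right.trans hB).trans (centralizer_le inf_le_right)
  have hMD : M ≤ centralizer (D : Set G) := inf_le_left.trans hDE
  have hE : M ⊔ A = E := by
    refine le_antisymm (sup_le inf_le_left le_sup_left) (sup_le le_sup_right ?_)
    rintro _ ⟨a, ha, rfl⟩
    have h1 : b * (a * b⁻¹ * a⁻¹) ∈ M := by
      refine ⟨?_, mul_mem hbB ((mem_normalizer_iff.1 (hAB ha) _).1 (inv_mem hbB))⟩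
      have : b * (a * b⁻¹ * a⁻¹) = MulAut.conj b a * a⁻¹ := by simp [mul_assoc]
      rw [this]
      exact mul_mem (mem_sup_right ⟨a, ha, rfl⟩) (mem_sup_left (inv_mem ha))
    have h2 : b * (a * b⁻¹ * a⁻¹) * a ∈ M ⊔ A := mul_mem_sup h1 ha
    simpa [mul_assoc] using h2
  have hABD : A ⊓ B ≤ D := fun x hx => by
    refine ⟨hx.1, (hmem₁ x).2 ?_⟩
    have hc : b * x = x * b := mem_centralizer_iff.1 (hB hx.2) b hbB
    rw [mul_assoc, ← hc, inv_mul_cancel_left]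
    exact hx.1
  have hABM : A ⊓ B ≤ M := le_inf (inf_le_left.trans le_sup_left) inf_le_right
  have hMA : M ⊓ A = M ⊓ D := by
    refine le_antisymm (fun x hx => ⟨hx.1, hABD ⟨hx.2, hx.1.2⟩⟩)
      (inf_le_inf_left M inf_le_left)
  have hc1 : Nat.card E * Nat.card D = Nat.card A * Nat.card A := by
    rw [card_sup_mul_card_inf hAA₁, hcard₁]
  have hc2 : Nat.card E * Nat.card (M ⊓ D : Subgroup G) = Nat.card M * Nat.card A := by
    rw [← hMA, ← card_sup_mul_card_inf (inf_le_left.trans hEA : M ≤ normalizer (A : Set G)), hE]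
  have hc3 : Nat.card (M ⊔ D : Subgroup G) * Nat.card (M ⊓ D : Subgroup G) =
      Nat.card M * Nat.card D :=
    card_sup_mul_card_inf (hMD.trans (centralizer_le_normalizer _))
  have hcard : Nat.card (M ⊔ D : Subgroup G) = Nat.card A := by
    have hA0 : 0 < Nat.card A := Nat.card_pos
    have hI0 : 0 < Nat.card (M ⊓ D : Subgroup G) := Nat.card_pos
    refine Nat.eq_of_mul_eq_mul_right (Nat.mul_pos hI0 hA0) ?_
    calc Nat.card (M ⊔ D : Subgroup G) * (Nat.card (M ⊓ D : Subgroup G) * Nat.card A)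
        = Nat.card M * Nat.card D * Nat.card A := by rw [← mul_assoc, hc3]
      _ = Nat.card M * Nat.card A * Nat.card D := by ring
      _ = Nat.card E * Nat.card D * Nat.card (M ⊓ D : Subgroup G) := by rw [← hc2]; ring
      _ = Nat.card A * (Nat.card (M ⊓ D : Subgroup G) * Nat.card A) := by rw [hc1]; ring
  refine ⟨M ⊔ D, ⟨?_, ?_, ?_⟩, ?_, ?_⟩
  · exact sup_le (inf_le_right.trans hBS) (inf_le_left.trans hA.le)
  · refine sup_le ?_ ?_
    · exact le_centralizer_iff.1 (sup_le hMc (le_centralizer_iff.1 hMD))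
    · exact le_centralizer_iff.1 (sup_le hMD (hDle.trans hDE))
  · rw [hcard]
    exact hA.card_le
  -- Equality would give `M ≤ A`, hence `E = A` and `A₁ = A`, so that `b` normalizes `A`.
  · refine lt_of_le_of_ne (le_inf (hABM.trans le_sup_left) inf_le_right) fun h => hbA ?_
    have hMA' : M ≤ A := (le_inf le_sup_left inf_le_right).trans (h.ge.trans inf_le_left)
    have hEA' : E ≤ A := hE ▸ sup_le hMA' le_rfl
    have : A₁ = A := eq_of_le_of_card_ge (le_sup_right.trans hEA') hcard₁.ge
    exact mem_normalizer_iff_map_conj_eq.2 this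
  · exact sup_le (inf_le_left.trans hEA) (hDle.trans hEA)

/-- An element `x` whose order is invertible commutes with the unipotent element `a` of degree two
if it commutes with its conjugates under `a`. -/
theorem commute_of_sub_one_sq_eq_zero {R : Type*} [Ring R] {a a' x : R} {m : ℕ}
    (haa' : a * a' = 1) (hsq : (a - 1) * (a - 1) = 0) (hx : x ^ m = 1)
    (h2 : ∀ f : R, (2 : ℕ) • f = 0 → f = 0) (hm : ∀ f : R, m • f = 0 → f = 0)
    (h₁ : Commute x (a' * x * a)) (h₂ : Commute x (a * x * a')) : Commute x a := by
  obtain ⟨n, rfl⟩ : ∃ n, a = 1 + n := ⟨a - 1, by abel⟩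
  have hn : n * n = 0 := by simpa using hsq
  have ha' : a' = 1 - n := by
    calc a' = (1 - n * n) * a' := by rw [hn, sub_zero, one_mul]
      _ = (1 - n) * ((1 + n) * a') := by noncomm_ring
      _ = 1 - n := by rw [haa', mul_one]
  subst ha'
  -- The two conjugates of `x` differ by `2d`, so `x` commutes with `d`.
  set d := x * n - n * x with hd
  have hxd : Commute x d := by
    have h3 := h₁.sub_right h₂
    have h4 : (1 - n) * x * (1 + n) - (1 + n) * x * (1 - n) = (2 : ℕ) • d := by
      rw [hd]; noncomm_ring
    rw [h4] at h3
    refine sub_eq_zero.1 (h2 _ ?_)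
    rw [smul_sub, ← mul_smul_comm, ← smul_mul_assoc, sub_eq_zero]
    exact h3
  -- The rule `[xᵏ, n] = k xᵏ⁻¹ d`, multiplied by `x` to avoid the exponent `k - 1`. For `k = m` it
  -- reads `m d = 0`.
  have hpow : ∀ k : ℕ, x * (x ^ k * n - n * x ^ k) = k • (x ^ k * d) := by
    intro k
    induction k with
    | zero => simp
    | succ k ih =>
      have hk : x ^ k * (x * d) = x * (x ^ k * d) := by
        rw [← mul_assoc, ← mul_assoc, (Commute.pow_self x k).eq]
      calc x * (x ^ (k + 1) * n - n * x ^ (k + 1))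
          = x * (x ^ k * d) + x * (x ^ k * n - n * x ^ k) * x := by
            rw [hd, pow_succ]; noncomm_ring
        _ = x * (x ^ k * d) + (k • (x ^ k * d)) * x := by rw [ih]
        _ = x ^ (k + 1) * d + k • (x ^ (k + 1) * d) := by
            rw [smul_mul_assoc, mul_assoc (x ^ k), ← hxd.eq, pow_succ, mul_assoc, hk]
        _ = (k + 1) • (x ^ (k + 1) * d) := by rw [add_smul, one_smul, add_comm]
  have h0 := hpow m
  rw [hx, one_mul, mul_one, sub_self, mul_zero, one_mul] at h0
  have hd0 : d = 0 := hm d h0.symm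
  have : Commute x n := sub_eq_zero.1 hd0
  exact (Commute.one_right x).add_right this

end Thompson

end FiniteGroup

/-! ### Quadratic action on an abelian normal subgroup. -/

namespace FiniteGroup

open Subgroup

open scoped commutatorElement

section Quadratic

variable {L : Type*} [Group L]

open scoped IsMulCommutative in
/-- The action by conjugation on an abelian normal subgroup, as endomorphisms of an additive
group. -/
def conjEnd (V : Subgroup L) [V.Normal] [IsMulCommutative V] :
    L →* AddMonoid.End (Additive V) where
  toFun g := MonoidHom.toAdditive (MulAut.conjNormal g : MulAut V).toMonoidHom
  map_one' := by
    refine AddMonoidHom.ext fun v => ?_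
    refine congrArg Additive.ofMul (Subtype.ext ?_)
    exact (MulAut.conjNormal_apply 1 v.toMul).trans (by rw [one_mul, inv_one, mul_one]; rfl)
  map_mul' a b := by
    refine AddMonoidHom.ext fun v => ?_
    refine congrArg Additive.ofMul (Subtype.ext ?_)
    refine (MulAut.conjNormal_apply (a * b) v.toMul).trans ?_
    refine Eq.trans ?_ (MulAut.conjNormal_apply a (MulAut.conjNormal b v.toMul)).symm
    rw [MulAut.conjNormal_apply]
    group

variable {V : Subgroup L} [V.Normal] [IsMulCommutative V]

theorem conjEnd_apply (g : L) (v : Additive V) :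
    ((conjEnd V g v).toMul : L) = g * (v.toMul : L) * g⁻¹ := rfl

theorem conjEnd_eq_one_iff {g : L} : conjEnd V g = 1 ↔ g ∈ centralizer (V : Set L) := by
  constructor
  · intro h
    refine mem_centralizer_iff.2 fun v hv => ?_
    have := conjEnd_apply g (Additive.ofMul (⟨v, hv⟩ : V))
    rw [h] at this
    exact (eq_mul_inv_iff_mul_eq.1 this)
  · intro h
    refine DFunLike.ext _ _ fun v => ?_
    have hv : (v.toMul : L) * g = g * v.toMul := mem_centralizer_iff.1 h _ v.toMul.2
    have : ((conjEnd V g v).toMul : L) = v.toMul := by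
      rw [conjEnd_apply, ← hv, mul_inv_cancel_right]
    exact congrArg Additive.ofMul (Subtype.ext this)

theorem commute_conjEnd_iff {x y : L} :
    Commute (conjEnd V x) (conjEnd V y) ↔ ⁅x, y⁆ ∈ centralizer (V : Set L) := by
  rw [← conjEnd_eq_one_iff, commutatorElement_def]
  constructor
  · intro h
    rw [mul_assoc, map_mul, map_mul, h.eq, ← map_mul, ← map_mul]
    simp [mul_assoc]
  · intro h
    change conjEnd V x * conjEnd V y = conjEnd V y * conjEnd V x
    rw [← map_mul, ← map_mul]
    calc conjEnd V (x * y) = conjEnd V ((x * y * x⁻¹ * y⁻¹) * (y * x)) := by simp [mul_assoc]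
      _ = conjEnd V (y * x) := by rw [map_mul, h, one_mul]

open scoped IsMulCommutative in
theorem addMonoidEnd_eq_zero_of_smul_eq_zero [Finite L] {V : Subgroup L} [IsMulCommutative V] {k : ℕ} (hk : k.Coprime (Nat.card V))
    (f : AddMonoid.End (Additive V)) (h : k • f = 0) : f = 0 := by
  refine DFunLike.ext _ _ fun v => ?_
  have h1 : k • f v = 0 := DFunLike.congr_fun h v
  obtain ⟨w, hw⟩ : ∃ w : V, f v = Additive.ofMul w := ⟨(f v).toMul, rfl⟩
  rw [hw] at h1 ⊢
  have h2 : w ^ k = 1 := h1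
  have : orderOf w = 1 := Nat.eq_one_of_dvd_coprimes hk
    (orderOf_dvd_of_pow_eq_one h2) (_root_.orderOf_dvd_natCard w)
  exact congrArg Additive.ofMul (orderOf_eq_one_iff.1 this)

open scoped IsMulCommutative in
-- By `hquad` the action of `a` on `V` satisfies `(a - 1)² = 0`, so `commute_of_sub_one_sq_eq_zero`
-- applies in the endomorphism ring of `V`, where `2` and `m` can be cancelled.
theorem commutator_mem_centralizer_of_quadratic [Finite L] {a x : L} {m : ℕ}
    (h2 : Nat.Coprime 2 (Nat.card V)) (hm : m.Coprime (Nat.card V))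
    (hxm : x ^ m ∈ centralizer (V : Set L))
    (hquad : ∀ v ∈ V, a * (a * v * a⁻¹ * v⁻¹) = a * v * a⁻¹ * v⁻¹ * a)
    (h₁ : ⁅x, a⁻¹ * x * a⁆ ∈ centralizer (V : Set L))
    (h₂ : ⁅x, a * x * a⁻¹⁆ ∈ centralizer (V : Set L)) : ⁅x, a⁆ ∈ centralizer (V : Set L) := by
  rw [← commute_conjEnd_iff] at h₁ h₂ ⊢
  rw [map_mul, map_mul] at h₁ h₂
  refine commute_of_sub_one_sq_eq_zero (a' := conjEnd V a⁻¹) (m := m) ?_ ?_ ?_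
    (addMonoidEnd_eq_zero_of_smul_eq_zero h2) (addMonoidEnd_eq_zero_of_smul_eq_zero hm) h₁ h₂
  · rw [← map_mul, mul_inv_cancel, map_one]
  · refine DFunLike.ext _ _ fun v => ?_
    set w : Additive V := (conjEnd V a - 1) v with hw
    have hwv : (w.toMul : L) = a * v.toMul * a⁻¹ * (v.toMul : L)⁻¹ := by
      have : w = conjEnd V a v + -v := sub_eq_add_neg _ _
      rw [this]
      rfl
    have hfix : conjEnd V a w = w := by
      have : ((conjEnd V a w).toMul : L) = w.toMul := by
        rw [conjEnd_apply, hwv, hquad _ v.toMul.2, mul_inv_cancel_right]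
      exact congrArg Additive.ofMul (Subtype.ext this)
    change conjEnd V a w - w = 0
    rw [hfix, sub_self]
  · rw [← map_pow, conjEnd_eq_one_iff]
    exact hxm

end Quadratic

/-! ### Local structure of a minimal counterexample to Thompson's criterion. -/

section LocalAnalysis

variable {L : Type*} [Group L] {q : ℕ}

theorem pow_relIndex_mem (H : Subgroup L) [H.Normal] {K : Subgroup L} {k : L} (hk : k ∈ K) :
    k ^ H.relIndex K ∈ H :=
  pow_index_mem (H.subgroupOf K) (⟨k, hk⟩ : K)

theorem relIndex_sup_of_normal [Finite L] (X M : Subgroup L) [M.Normal] :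
    X.relIndex (X ⊔ M) = X.relIndex M := by
  have h := card_sup_mul_card_inf (le_normalizer_of_normal : X ≤ normalizer (M : Set L))
  rw [← card_mul_relIndex (le_sup_left : X ≤ X ⊔ M),
    ← card_mul_relIndex (inf_le_right : X ⊓ M ≤ M), inf_relIndex_right] at h
  have hX : 0 < Nat.card X := Nat.card_pos
  have hXM : 0 < Nat.card (X ⊓ M : Subgroup L) := Nat.card_pos
  refine Nat.eq_of_mul_eq_mul_right (Nat.mul_pos hX hXM) ?_
  linarith

/-- The situation in which the local structure of a group of characteristic `q` is analysed: all
proper subgroups that contain the Sylow `q`-subgroup `S` are `q`-nilpotent but `L` is not, `H` is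
the largest normal `q`-subgroup and `K / H` is a normal `q`-complement of `L / H`. -/
structure LocalConfig (S : Sylow q L) (H K : Subgroup L) : Prop where
  H_normal : H.Normal
  K_normal : K.Normal
  H_isPGroup : IsPGroup q H
  le_H : ∀ X : Subgroup L, X.Normal → IsPGroup q X → X ≤ H
  H_le_K : H ≤ K
  not_dvd : ¬ q ∣ H.relIndex K
  mem_K : ∀ x : L, ¬ q ∣ orderOf x → x ∈ K
  sup_eq_top : K ⊔ S = ⊤
  proper : ∀ X : Subgroup L, S ≤ X → X ≠ ⊤ → IsPNilpotent q X
  not_isPNilpotent : ¬ IsPNilpotent q (⊤ : Subgroup L)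

namespace LocalConfig

variable {S : Sylow q L} {H K : Subgroup L}

theorem H_le_sylow (c : LocalConfig S H K) (T : Sylow q L) : H ≤ T :=
  have := c.H_normal
  c.H_isPGroup.le_sylow_of_normal T

theorem not_isPNilpotent_K (c : LocalConfig S H K) : ¬ IsPNilpotent q K := fun h =>
  c.not_isPNilpotent fun x _ y _ hx hy => h x (c.mem_K x hx) y (c.mem_K y hy) hx hy

theorem not_dvd_of_le (c : LocalConfig S H K) {M : Subgroup L} (hMK : M ≤ K) :
    ¬ q ∣ H.relIndex M := by
  have := c.H_normal
  intro h
  refine c.not_dvd (h.trans ?_)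
  rw [← relIndex_sup_right, ← relIndex_mul_relIndex H (M ⊔ H) K le_sup_right
    (sup_le hMK c.H_le_K)]
  exact dvd_mul_right _ _

variable [Finite L] [Fact q.Prime]

theorem le_H_of_isPGroup (c : LocalConfig S H K) {X : Subgroup L} (hX : IsPGroup q X)
    (hXK : X ≤ K) : X ≤ H := by
  have := c.H_normal
  have h1 : H.relIndex X ∣ H.relIndex K := by
    rw [← relIndex_sup_right, ← relIndex_mul_relIndex H (X ⊔ H) K le_sup_right
      (sup_le hXK c.H_le_K)]
    exact dvd_mul_right _ _
  obtain ⟨n, hn⟩ := (IsPGroup.iff_card).1 hX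
  have h2 : H.relIndex X ∣ q ^ n := hn ▸ relIndex_dvd_card H X
  rw [← relIndex_eq_one]
  obtain ⟨m, -, hm⟩ := (Nat.dvd_prime_pow Fact.out).1 h2
  rw [hm] at h1 ⊢
  rcases m.eq_zero_or_pos with rfl | hm0
  · rfl
  · exact absurd ((dvd_pow_self q hm0.ne').trans h1) c.not_dvd

theorem proper_of_sylow (c : LocalConfig S H K) (T : Sylow q L) {X : Subgroup L} (hT : T ≤ X)
    (hX : X ≠ ⊤) : IsPNilpotent q X := by
  obtain ⟨g, hg⟩ := MulAction.exists_smul_eq L T S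
  rw [← isPNilpotent_map_iff_of_injective (f := (MulAut.conj g).toMonoidHom)
    (MulAut.conj g).injective]
  refine c.proper _ ?_ fun h => hX ?_
  · rw [← hg]
    exact map_mono hT
  · refine map_injective (MulAut.conj g).injective (h.trans ?_)
    exact (map_top_of_surjective _ (MulAut.conj g).surjective).symm

/-- `MS` is proper: otherwise `K = M(S ⊓ K)`, while `S ⊓ K ≤ H ≤ M`. -/
theorem isPNilpotent_of_ne (c : LocalConfig S H K) {M : Subgroup L} (hM : M.Normal) (hHM : H ≤ M)
    (hMK : M ≤ K) (hne : M ≠ K) : IsPNilpotent q M := by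
  refine (c.proper (M ⊔ S) le_sup_right fun htop => hne (le_antisymm hMK fun k hk => ?_)).mono
    le_sup_left
  obtain ⟨m, hm, s, hs, rfl⟩ := mem_sup_of_normal_left.1 (htop ▸ mem_top k : k ∈ M ⊔ S)
  have hsK : s ∈ K := (K.mul_mem_cancel_left (hMK hm)).1 hk
  exact mul_mem hm (hHM (c.le_H_of_isPGroup (S.2.to_le inf_le_left) inf_le_right
    (⟨hs, hsK⟩ : s ∈ (S : Subgroup L) ⊓ K)))

/-- An element of `S` that centralizes `K` modulo a `q`-nilpotent normal subgroup lies in `H`. -/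
theorem mem_H_of_commutator_mem (c : LocalConfig S H K) {M : Subgroup L} (hM : M.Normal)
    (hHM : H ≤ M) (hMK : M ≤ K) (hMp : IsPNilpotent q M) {x : L} (hx : x ∈ S)
    (hxK : ∀ k ∈ K, ⁅x, k⁆ ∈ M) : x ∈ H := by
  have hHn := c.H_normal
  have hKn := c.K_normal
  have hKm : (K.map (QuotientGroup.mk' M)).Normal :=
    hKn.map _ (QuotientGroup.mk'_surjective M)
  set W : Subgroup L := (centralizer (K.map (QuotientGroup.mk' M) : Set (L ⧸ M))).comap
    (QuotientGroup.mk' M) with hW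
  have hWn : W.Normal := inferInstance
  have hWmem : ∀ y, y ∈ W ↔ ∀ k ∈ K, ⁅y, k⁆ ∈ M := by
    intro y
    rw [hW, mem_comap, mem_centralizer_iff]
    constructor
    · intro h k hk
      have := h _ (mem_map_of_mem _ hk)
      rw [← QuotientGroup.eq_one_iff, ← QuotientGroup.mk'_apply, map_commutatorElement,
        commutatorElement_eq_one_iff_mul_comm]
      exact this.symm
    · rintro h _ ⟨k, hk, rfl⟩
      have := h k hk
      rw [← QuotientGroup.eq_one_iff, ← QuotientGroup.mk'_apply, map_commutatorElement,
        commutatorElement_eq_one_iff_mul_comm] at this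
      exact this.symm
  -- If `X` were normal, it would lie in `H`. Otherwise its normalizer is a proper subgroup
  -- containing `S`, hence `q`-nilpotent.
  set X : Subgroup L := S ⊓ W with hX
  have hXp : IsPGroup q X := S.2.to_le inf_le_left
  by_contra hxH
  have hXn : ¬ X.Normal := fun h => hxH (c.le_H X h hXp ⟨hx, (hWmem x).2 hxK⟩)
  have hHX : H ≤ X := le_inf (c.H_le_sylow S) fun h hh => (hWmem h).2 fun k _ => by
    have := hHM (H.mul_mem hh (hHn.conj_mem _ (H.inv_mem hh) k))
    simpa [commutatorElement_def, mul_assoc] using this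
  have hSX : (S : Subgroup L) ≤ normalizer (X : Set L) := le_normalizer_iff.2 fun s hs y hy =>
    ⟨S.mul_mem (S.mul_mem hs hy.1) (S.inv_mem hs), hWn.conj_mem y hy.2 s⟩
  have hNp : IsPNilpotent q (normalizer (X : Set L)) :=
    c.proper _ hSX fun h => hXn (normalizer_eq_top_iff.1 h)
  have hYn : (X ⊔ M).Normal := by
    rw [← normalizer_eq_top_iff, ← top_le_iff, ← c.sup_eq_top]
    refine sup_le (le_normalizer_iff.2 fun k hk y hy => ?_) ?_
    · obtain ⟨z, hz, m, hm, rfl⟩ := mem_sup_of_normal_right.1 hy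
      have h1 : k * (z * m) * k⁻¹ = z * (⁅z⁻¹, k⁆ * (k * m * k⁻¹)) := by
        simp [commutatorElement_def, mul_assoc]
      rw [h1]
      exact mul_mem_sup hz (mul_mem ((hWmem _).1 (inv_mem hz.2) k hk) (hM.conj_mem m hm k))
    · exact (le_inf hSX le_normalizer_of_normal).trans
        (normalizer_inf_normalizer_le_normalizer_sup X M)
  have hi : ¬ q ∣ (X.subgroupOf (X ⊔ M)).index := by
    change ¬ q ∣ X.relIndex (X ⊔ M)
    rw [relIndex_sup_of_normal]
    exact fun h => c.not_dvd_of_le hMK (h.trans (relIndex_dvd_of_le_left M hHX))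
  -- Frattini's argument in the normal subgroup `XM`, where `X` is Sylow, gives `L = N(X)M`. Since
  -- `H ≤ X`, this is `N(X)` times the normal complement of `M`, so `L` would be `q`-nilpotent.
  have hF := Sylow.normalizer_sup_eq_top
    ((hXp.comap_subtype : IsPGroup q (X.subgroupOf (X ⊔ M))).toSylow hi)
  have hXe : (X.subgroupOf (X ⊔ M)).map (X ⊔ M).subtype = X := by
    rw [subgroupOf_map_subtype, inf_of_le_left le_sup_left]
  change normalizer ((X.subgroupOf (X ⊔ M)).map (X ⊔ M).subtype : Set L) ⊔ (X ⊔ M) = ⊤ at hF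
  rw [hXe] at hF
  have hMle := hMp.le_complement_sup (c.not_dvd_of_le hMK)
  have hcn := hMp.complement_normal
  refine c.not_isPNilpotent ((IsPNilpotent.sup_of_normal (N := hMp.complement) (fun _ h => h.2)
    hNp).mono ?_)
  rw [← hF]
  refine sup_le le_sup_right (sup_le (le_normalizer.trans le_sup_right) (hMle.trans ?_))
  exact sup_le_sup_left (hHX.trans le_normalizer) _

/-- A Sylow `q`-subgroup of `K ⊓ C(H)` lies in `H`, hence is central there, so `M = H(K ⊓ C(H))` is
`q`-nilpotent. It contains all commutators of `x` with `K`. -/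
theorem mem_H_of_mem_centralizer (c : LocalConfig S H K) {x : L} (hx : x ∈ S)
    (hxH : x ∈ centralizer (H : Set L)) : x ∈ H := by
  have hHn := c.H_normal
  have hKn := c.K_normal
  have hCn : (centralizer (H : Set L)).Normal := inferInstance
  set C := K ⊓ centralizer (H : Set L) with hC
  have hCnor : C.Normal := inferInstance
  have hCp : IsPNilpotent q C := by
    refine isPNilpotent_of_central (Z := H ⊓ C) (c.H_isPGroup.to_le inf_le_left)
      (fun x hx z hz => (mem_centralizer_iff.1 hx.2 z hz.1).symm) ?_
    rw [inf_relIndex_right]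
    exact c.not_dvd_of_le inf_le_left
  have hcn := hCp.complement_normal
  have hMp : IsPNilpotent q (H ⊔ C) := by
    refine (IsPNilpotent.sup_of_normal (N := hCp.complement) (fun _ h => h.2)
      (isPNilpotent_of_isPGroup c.H_isPGroup)).mono (sup_le le_sup_right ?_)
    exact hCp.le_complement_sup (c.not_dvd_of_le inf_le_left)
  refine c.mem_H_of_commutator_mem (M := H ⊔ C) inferInstance le_sup_left
    (sup_le c.H_le_K inf_le_left) hMp hx fun k hk => mem_sup_right ⟨?_, ?_⟩
  · exact K.mul_mem (hKn.conj_mem k hk x) (K.inv_mem hk)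
  · have := mul_mem hxH (hCn.conj_mem _ (inv_mem hxH) k)
    simpa [commutatorElement_def, mul_assoc] using this

/-- If `K / H` is not a group of prime power order, then for each prime `r ≠ q` the Sylow
`r`-subgroups of `K` centralize `H`. -/
theorem sylow_le_centralizer (c : LocalConfig S H K) {r : ℕ} [Fact r.Prime] (hr : r ≠ q)
    (R : Sylow r K) (hne : (R : Subgroup K).map K.subtype ⊔ H ≠ K) :
    (R : Subgroup K).map K.subtype ≤ centralizer (H : Set L) := by
  have hHn := c.H_normal
  have hKn := c.K_normal
  set R' := (R : Subgroup K).map K.subtype with hR'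
  have hR'K : R' ≤ K := map_subtype_le _
  set Y := R' ⊔ H
  have hYK : Y ≤ K := sup_le hR'K c.H_le_K
  set N := normalizer (Y : Set L)
  have hHN : H ≤ N := le_sup_right.trans le_normalizer
  -- By Frattini's argument `N` has index prime to `q`, so it contains a Sylow `q`-subgroup `T` of
  -- `L`. Then `TY` is proper, as `T ⊓ K ≤ H ≤ Y ≠ K`, and in this `q`-nilpotent group `R'`
  -- centralizes `H`.
  have hNK : N ⊔ K = ⊤ := by
    rw [← top_le_iff, ← Sylow.normalizer_sup_eq_top R]
    exact sup_le_sup_right normalizer_le_normalizer_sup_normal K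
  have hNi : ¬ q ∣ N.index := by
    rw [← relIndex_top_right, ← hNK, relIndex_sup_of_normal]
    exact fun h => c.not_dvd (h.trans (relIndex_dvd_of_le_left K hHN))
  let T₀ : Sylow q N := default
  have hTi : ¬ q ∣ ((T₀ : Subgroup N).map N.subtype).index := by
    rw [index_map_subtype]
    exact fun h => ((Fact.out : q.Prime).dvd_mul.1 h).elim T₀.not_dvd_index hNi
  let T : Sylow q L := (T₀.2.map N.subtype).toSylow hTi
  have hTN : (T : Subgroup L) ≤ N := map_subtype_le _
  have hTY : (T : Subgroup L) ⊔ Y ≠ ⊤ := by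
    intro htop
    refine hne (le_antisymm hYK fun k hk => ?_)
    obtain ⟨t, ht, y, hy, rfl⟩ := (mem_sup_of_le_normalizer hTN).1 (htop ▸ mem_top k)
    have htK : t ∈ K := (K.mul_mem_cancel_right (hYK hy)).1 hk
    refine mul_mem (mem_sup_right ?_) hy
    exact c.le_H_of_isPGroup (T.2.to_le inf_le_left) inf_le_right
      (⟨ht, htK⟩ : t ∈ (T : Subgroup L) ⊓ K)
  have hp := c.proper_of_sylow T le_sup_left hTY
  intro x hx
  refine mem_centralizer_iff.2 fun h hh => ?_
  refine (hp.commute c.H_isPGroup ((c.H_le_sylow T).trans le_sup_left) le_normalizer_of_normal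
    (mem_sup_right (mem_sup_left hx)) ?_ hh).symm
  obtain ⟨n, hn⟩ := IsPGroup.iff_orderOf.1 (R.2.map K.subtype) ⟨x, hx⟩
  rw [orderOf_mk] at hn
  rw [hn]
  intro hd
  exact hr ((Nat.prime_dvd_prime_iff_eq Fact.out Fact.out).1
    ((Fact.out : q.Prime).dvd_of_dvd_pow hd)).symm

/-- If `K / H` has prime power order, it is nilpotent and `D = K'H` works. Otherwise the Sylow
subgroups of `K` for primes other than `q` centralize the normal Sylow subgroup `H`, making `K`
`q`-nilpotent. -/
theorem exists_normal_commutator_mem (c : LocalConfig S H K) :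
    ∃ D : Subgroup L, D.Normal ∧ H ≤ D ∧ D ≤ K ∧ D ≠ K ∧ ∀ x ∈ K, ∀ y ∈ K, ⁅x, y⁆ ∈ D := by
  have hHn := c.H_normal
  have hKn := c.K_normal
  by_cases hex : ∃ r, ∃ _ : Fact r.Prime, ∃ R : Sylow r K,
      (R : Subgroup K).map K.subtype ⊔ H = K
  · obtain ⟨r, _, R, hR⟩ := hex
    refine ⟨⁅K, K⁆ ⊔ H, inferInstance, le_sup_right, sup_le (commutator_le_left K K) c.H_le_K,
      fun heq => ?_, fun x hx y hy => mem_sup_left (commutator_mem_commutator hx hy)⟩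
    have hbot : H.map (QuotientGroup.mk' H) = ⊥ := (map_eq_bot_iff H).2 (by simp)
    have hK1 : K.map (QuotientGroup.mk' H) =
        ((R : Subgroup K).map K.subtype).map (QuotientGroup.mk' H) := by
      conv_lhs => rw [← hR, Subgroup.map_sup, hbot, sup_bot_eq]
    have hKr : IsPGroup r (K.map (QuotientGroup.mk' H)) := by
      rw [hK1]
      exact (R.2.map _).map _
    have hK0 : K.map (QuotientGroup.mk' H) = ⊥ := by
      refine eq_bot_of_le_commutator hKr le_rfl ?_
      conv_lhs => rw [← heq, Subgroup.map_sup, hbot, sup_bot_eq, map_commutator]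
    have hKH : K ≤ H := by simpa using (map_eq_bot_iff K).1 hK0
    refine c.not_isPNilpotent ?_
    rw [← c.sup_eq_top]
    exact isPNilpotent_of_isPGroup (S.2.to_le (sup_le (hKH.trans (c.H_le_sylow S)) le_rfl))
  · exfalso
    push Not at hex
    have hHs : IsPGroup q (H.subgroupOf K) := c.H_isPGroup.comap_subtype
    let P : Sylow q K := hHs.toSylow c.not_dvd
    have hPn : P.Normal := (inferInstance : (H.subgroupOf K).Normal)
    refine c.not_isPNilpotent_K (isPNilpotent_top_iff.1 (isPNilpotent_top_of_forall_sylow P ?_))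
    intro r hr hrq
    refine ⟨default, fun x hx => mem_centralizer_iff.2 fun y hy => Subtype.ext ?_⟩
    exact mem_centralizer_iff.1 (c.sylow_le_centralizer hrq default (hex r hr default)
      (mem_map_of_mem _ hx)) y hy

/-- `K` acts on `Z(H)` as an abelian group, because `D` acts trivially: it is the product of its
normal complement, which centralizes `H`, and `H`. -/
theorem commutator_mem_centralizer (c : LocalConfig S H K) {x y : L} (hx : x ∈ K) (hy : y ∈ K) :
    ⁅x, y⁆ ∈ centralizer (centerIn H : Set L) := by
  obtain ⟨D, hDn, hHD, hDK, hne, hD⟩ := c.exists_normal_commutator_mem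
  have hHn := c.H_normal
  have hDp := c.isPNilpotent_of_ne hDn hHD hDK hne
  refine (hDp.le_complement_sup (c.not_dvd_of_le hDK)).trans (sup_le ?_ ?_) (hD x hx y hy)
  · intro z hz
    exact mem_centralizer_iff.2 fun v hv =>
      (hDp.commute c.H_isPGroup hHD le_normalizer_of_normal hz.1 hz.2 hv.1).symm
  · exact le_centralizer_iff.1 inf_le_right

/-- Let `V = Z(H)`. If `K` centralizes `V`, then `Z(S) ≤ V` is central in `L`. If not, and `J(S)` is
not normal, take `A` abelian of largest order outside `H` with `A ⊓ V` as large as possible. When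
`V` normalizes `A`, the action of `A` on `V` is quadratic and forces `A ≤ H`; when it does not,
replacement applies. -/
theorem centerIn_normal_or_thompsonSubgroup_normal (c : LocalConfig S H K) (hq : q ≠ 2) :
    (centerIn (S : Subgroup L)).Normal ∨ (thompsonSubgroup (S : Subgroup L)).Normal := by
  have hHn := c.H_normal
  have hKn := c.K_normal
  have hHS := c.H_le_sylow S
  set V := centerIn H with hV
  have hVn : V.Normal := (inferInstance : (H ⊓ centralizer (H : Set L)).Normal)
  have hVH : V ≤ H := inf_le_left
  have hHV : H ≤ centralizer (V : Set L) := le_centralizer_iff.1 inf_le_right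
  have hVV : V ≤ centralizer (V : Set L) := hVH.trans hHV
  have hVc : IsMulCommutative V := le_centralizer_iff_isMulCommutative.1 hVV
  by_cases hKV : K ≤ centralizer (V : Set L)
  · left
    refine ⟨fun z hz g => ?_⟩
    have hzH : z ∈ centralizer (H : Set L) := centralizer_le hHS hz.2
    have hzV : z ∈ V := ⟨c.mem_H_of_mem_centralizer hz.1 hzH, hzH⟩
    have htop : K ⊔ S ≤ centralizer {z} := by
      refine sup_le (hKV.trans (centralizer_le (by simpa using hzV))) ?_
      exact fun y hy => mem_centralizer_singleton_iff.2 (mem_centralizer_iff.1 hz.2 y hy)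
    rw [c.sup_eq_top] at htop
    have := mem_centralizer_singleton_iff.1 (htop (mem_top g))
    rw [this, mul_inv_cancel_right]
    exact hz
  right
  set M := K ⊓ centralizer (V : Set L) with hM
  have hMn : M.Normal := inferInstance
  have hHM : H ≤ M := le_inf c.H_le_K hHV
  have hMp : IsPNilpotent q M := c.isPNilpotent_of_ne hMn hHM inf_le_left
    fun h => hKV (inf_eq_left.1 h)
  by_contra hJ
  have hex : ∃ A, IsMaxAbelian (S : Subgroup L) A ∧ ¬ A ≤ H := by
    by_contra! hall
    refine hJ ?_
    rw [thompsonSubgroup_eq_of_forall_le hHS hall, ← normalizer_eq_top_iff, ← top_le_iff,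
      ← normalizer_eq_top (H := H)]
    exact normalizer_le_normalizer_thompsonSubgroup H
  obtain ⟨A, ⟨hA, hAH⟩, hmax⟩ := Set.exists_max_image
    {A | IsMaxAbelian (S : Subgroup L) A ∧ ¬ A ≤ H} (fun A => Nat.card (A ⊓ V : Subgroup L))
    (Set.toFinite _) hex
  by_cases hVA : V ≤ normalizer (A : Set L)
  · refine hAH fun a ha => ?_
    refine c.mem_H_of_commutator_mem hMn hHM inf_le_left hMp (hA.le ha) fun k hk => ⟨?_, ?_⟩
    · exact K.mul_mem (hKn.conj_mem k hk a) (K.inv_mem hk)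
    obtain ⟨n, hn⟩ := (IsPGroup.iff_card).1 (c.H_isPGroup.to_le hVH)
    have hqp : q.Prime := Fact.out
    -- The one place where `q` must be odd.
    have h2 : Nat.Coprime 2 (Nat.card V) := by
      rw [hn]
      exact ((Nat.coprime_primes Nat.prime_two hqp).2 hq.symm).pow_right n
    have hm : (H.relIndex K).Coprime (Nat.card V) := by
      rw [hn]
      exact ((hqp.coprime_iff_not_dvd.2 c.not_dvd).symm).pow_right n
    have hkm : k ^ H.relIndex K ∈ centralizer (V : Set L) :=
      hHV (pow_relIndex_mem H hk)
    have hka := commutator_mem_centralizer_of_quadratic (a := a) (x := k) h2 hm hkm ?_ ?_ ?_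
    · rw [← commutatorElement_inv]
      exact Subgroup.inv_mem _ hka
    · intro v hv
      have hmem : a * v * a⁻¹ * v⁻¹ ∈ A := by
        have := mul_mem ha ((mem_normalizer_iff.1 (hVA hv) _).1 (inv_mem ha))
        simpa [mul_assoc] using this
      exact mem_centralizer_iff.1 (hA.comm hmem) a ha
    · refine c.commutator_mem_centralizer hk ?_
      simpa using hKn.conj_mem k hk a⁻¹
    · exact c.commutator_mem_centralizer hk (hKn.conj_mem k hk a)
  · obtain ⟨A', hA', hlt, hAn⟩ := hA.exists_replacement S.2 (hVH.trans hHS) hVV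
      le_normalizer_of_normal hVA
    -- By the choice of `A`. Then `A'V` is abelian, so `V ≤ A'` by maximality of the order, although
    -- `A'` normalizes `A`.
    have hA'H : A' ≤ H := by
      by_contra h
      have hcard : Nat.card (A ⊓ V : Subgroup L) < Nat.card (A' ⊓ V : Subgroup L) :=
        Set.ncard_lt_ncard (SetLike.coe_ssubset_coe.2 hlt) (Set.toFinite _)
      exact absurd (hmax A' ⟨hA', h⟩) (not_le.2 hcard)
    have hA'V : A' ≤ centralizer (V : Set L) := hA'H.trans hHV
    have hab : A' ⊔ V ≤ centralizer ((A' ⊔ V : Subgroup L) : Set L) := by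
      refine sup_le (le_centralizer_iff.1 (sup_le hA'.comm (le_centralizer_iff.1 hA'V)))
        (le_centralizer_iff.1 (sup_le hA'V hVV))
    have hle := hA'.card_le _ (sup_le hA'.le (hVH.trans hHS)) hab
    have heq : A' = A' ⊔ V := eq_of_le_of_card_ge le_sup_left hle
    exact hVA ((heq ▸ le_sup_right : V ≤ A').trans hAn)

end LocalConfig

end LocalAnalysis

end FiniteGroup

/-! ### Thompson's normal q-complement criterion. -/

namespace FiniteGroup

open Subgroup

section NormalComplement

universe u

variable {q : ℕ}

theorem exists_largest_normal_isPGroup {G : Type u} [Group G] [Finite G] :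
    ∃ H : Subgroup G, H.Normal ∧ IsPGroup q H ∧
      ∀ X : Subgroup G, X.Normal → IsPGroup q X → X ≤ H := by
  obtain ⟨H, ⟨hHn, hHp⟩, hmax⟩ := Set.exists_max_image
    {X : Subgroup G | X.Normal ∧ IsPGroup q X} (fun X => Nat.card X) (Set.toFinite _)
    ⟨⊥, inferInstance, IsPGroup.of_bot⟩
  refine ⟨H, hHn, hHp, fun X hX hXp => ?_⟩
  have := eq_of_le_of_card_ge (le_sup_left : H ≤ H ⊔ X)
    (hmax _ ⟨sup_normal H X, hHp.to_sup_of_normal_right hXp⟩)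
  exact this ▸ le_sup_right

variable [Fact q.Prime]

theorem isPNilpotent_normalizer_of_sylow {G : Type u} [Group G] [Finite G]
    {Φ : Subgroup G → Subgroup G}
    (hΦ : ∀ (f : G →* G) (_ : Function.Injective f) (S : Subgroup G), Φ (S.map f) = (Φ S).map f)
    {P : Sylow q G} (h : IsPNilpotent q (normalizer (Φ P : Set G))) (T : Sylow q G) :
    IsPNilpotent q (normalizer (Φ T : Set G)) := by
  obtain ⟨g, rfl⟩ := MulAction.exists_smul_eq G P T
  have h1 : ((g • P : Sylow q G) : Subgroup G) = (P : Subgroup G).map (MulAut.conj g).toMonoidHom :=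
    rfl
  have hb := (MulAut.conj g).bijective
  rw [h1, hΦ _ hb.1, ← map_equiv_normalizer_eq, isPNilpotent_map_iff_of_injective hb.1]
  exact h

theorem not_dvd_relIndex_of_maximal {G : Type u} [Group G] [Finite G] {S X : Subgroup G}
    (hS : IsPGroup q S) (hSX : S ≤ X)
    (h : ∀ T : Subgroup G, T ≤ X → IsPGroup q T → Nat.card T ≤ Nat.card S) :
    ¬ q ∣ S.relIndex X := by
  have hS' : IsPGroup q (S.subgroupOf X) := hS.comap_subtype
  obtain ⟨Q, hQ⟩ := hS'.exists_le_sylow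
  have hle : S ≤ (Q : Subgroup X).map X.subtype := by
    rw [← inf_eq_left.2 hSX, ← subgroupOf_map_subtype]
    exact map_mono hQ
  have heq := eq_of_le_of_card_ge hle (h _ (map_subtype_le _) (Q.2.map _))
  have : S.subgroupOf X = Q := by
    rw [heq, ← comap_subtype, comap_map_eq_self_of_injective X.subtype_injective]
  rw [relIndex, this]
  exact Q.not_dvd_index

theorem isPNilpotent_of_relIndex {G : Type u} [Group G] [Finite G] {S X : Subgroup G}
    (hX : ∀ P : Sylow q X, IsPNilpotent q (normalizer (centerIn (P : Subgroup X) : Set X)) →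
      IsPNilpotent q (normalizer (thompsonSubgroup (P : Subgroup X) : Set X)) →
      IsPNilpotent q (⊤ : Subgroup X))
    (hS : IsPGroup q S) (hSX : S ≤ X) (hi : ¬ q ∣ S.relIndex X)
    (hZ : IsPNilpotent q (normalizer (centerIn S : Set G)))
    (hJ : IsPNilpotent q (normalizer (thompsonSubgroup S : Set G))) : IsPNilpotent q X := by
  have hS' : IsPGroup q (S.subgroupOf X) := hS.comap_subtype
  have hmap : (S.subgroupOf X).map X.subtype = S := by
    rw [subgroupOf_map_subtype, inf_eq_left.2 hSX]
  rw [← isPNilpotent_top_iff]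
  refine hX (hS'.toSylow hi) ?_ ?_
  · change IsPNilpotent q (normalizer (centerIn (S.subgroupOf X) : Set X))
    rw [← isPNilpotent_map_iff_of_injective X.subtype_injective]
    refine hZ.mono ((le_normalizer_map _).trans ?_)
    rw [← centerIn_map X.subtype_injective, hmap]
  · change IsPNilpotent q (normalizer (thompsonSubgroup (S.subgroupOf X) : Set X))
    rw [← isPNilpotent_map_iff_of_injective X.subtype_injective]
    refine hJ.mono ((le_normalizer_map _).trans ?_)
    rw [← thompsonSubgroup_map X.subtype_injective, hmap]

/-- Among the `D` with bad normalizer, given by Frobenius' theorem, choose one whose normalizer has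
a largest `q`-subgroup `S`. If `S` were not Sylow in `G`, the normalizers of `Z(S)` and `J(S)` would
contain larger `q`-subgroups, hence be good, and induction would make `N(D)` good. So `S` is Sylow,
and the same induction shows `N(D) = G`. -/
theorem exists_normal_isPGroup_of_not_isPNilpotent {G : Type u} [Group G] [Finite G]
    (ih : ∀ X : Subgroup G, X ≠ ⊤ → ∀ S : Subgroup G, IsPGroup q S → S ≤ X → ¬ q ∣ S.relIndex X →
      IsPNilpotent q (normalizer (centerIn S : Set G)) →
      IsPNilpotent q (normalizer (thompsonSubgroup S : Set G)) → IsPNilpotent q X)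
    (hZ : ∀ P : Sylow q G, IsPNilpotent q (normalizer (centerIn (P : Subgroup G) : Set G)))
    (hJ : ∀ P : Sylow q G, IsPNilpotent q (normalizer (thompsonSubgroup (P : Subgroup G) : Set G)))
    (hG : ¬ IsPNilpotent q (⊤ : Subgroup G)) :
    ∃ D : Subgroup G, D ≠ ⊥ ∧ IsPGroup q D ∧ D.Normal := by
  have hex : ∃ D : Subgroup G, D ≠ ⊥ ∧ IsPGroup q D ∧
      ¬ IsPNilpotent q (normalizer (D : Set G)) := by
    by_contra! h
    exact hG (isPNilpotent_top_of_forall_normalizer h)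
  obtain ⟨D₀, hD₀, hD₀p, hD₀n⟩ := hex
  obtain ⟨⟨D, S⟩, ⟨hD, hDp, hDn, hSp, hSD⟩, hmax⟩ := Set.exists_max_image
    {x : Subgroup G × Subgroup G | x.1 ≠ ⊥ ∧ IsPGroup q x.1 ∧
      ¬ IsPNilpotent q (normalizer (x.1 : Set G)) ∧ IsPGroup q x.2 ∧
      x.2 ≤ normalizer (x.1 : Set G)} (fun x => Nat.card x.2) (Set.toFinite _)
    ⟨(D₀, D₀), hD₀, hD₀p, hD₀n, hD₀p, le_normalizer⟩
  dsimp only at hD hDp hDn hSp hSD hmax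
  have hSne : S ≠ ⊥ := by
    rintro rfl
    have := hmax (D, D) ⟨hD, hDp, hDn, hDp, le_normalizer⟩
    rw [card_bot] at this
    exact hD (eq_bot_of_card_le D this)
  have hi : ¬ q ∣ S.relIndex (normalizer (D : Set G)) :=
    not_dvd_relIndex_of_maximal hSp hSD fun T hT hTp => hmax (D, T) ⟨hD, hDp, hDn, hTp, hT⟩
  obtain ⟨P, hSP⟩ := hSp.exists_le_sylow
  have hP : S = P := by
    by_contra hne
    have hlt := lt_of_le_of_ne hSP hne
    have key : ∀ E : Subgroup G, E ≠ ⊥ → E ≤ S → normalizer (S : Set G) ≤ normalizer (E : Set G) →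
        IsPNilpotent q (normalizer (E : Set G)) := by
      intro E hE hES hn
      by_contra hEn
      have hlt' := lt_inf_normalizer P.2 hlt
      have := hmax (E, (P : Subgroup G) ⊓ normalizer (S : Set G))
        ⟨hE, hSp.to_le hES, hEn, P.2.to_le inf_le_left, inf_le_right.trans hn⟩
      exact absurd this (not_le.2
        (Set.ncard_lt_ncard (SetLike.coe_ssubset_coe.2 hlt') (Set.toFinite _)))
    refine hDn (ih _ (fun htop => ?_) S hSp hSD hi
      (key _ (centerIn_ne_bot hSp hSne) inf_le_left (normalizer_le_normalizer_centerIn S))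
      (key _ (thompsonSubgroup_ne_bot hSne) (thompsonSubgroup_le S)
        (normalizer_le_normalizer_thompsonSubgroup S)))
    have := hmax (D, P) ⟨hD, hDp, hDn, P.2, htop ▸ le_top⟩
    exact absurd this (not_le.2
      (Set.ncard_lt_ncard (SetLike.coe_ssubset_coe.2 hlt) (Set.toFinite _)))
  refine ⟨D, hD, hDp, normalizer_eq_top_iff.1 ?_⟩
  by_contra hne
  exact hDn (ih _ hne S hSp hSD hi (hP ▸ hZ P) (hP ▸ hJ P))

/-- For odd `q`, a finite group is `q`-nilpotent if the normalizers of the center and of the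
Thompson subgroup of a Sylow `q`-subgroup are. -/
theorem isPNilpotent_top_of_normalizer {G : Type u} [Group G] [Finite G] (hq : q ≠ 2)
    (P : Sylow q G) (hZ : IsPNilpotent q (normalizer (centerIn (P : Subgroup G) : Set G)))
    (hJ : IsPNilpotent q (normalizer (thompsonSubgroup (P : Subgroup G) : Set G))) :
    IsPNilpotent q (⊤ : Subgroup G) := by
  induction hn : Nat.card G using Nat.strong_induction_on generalizing G with
  | _ n ih =>
  subst hn
  by_contra hG
  have hsub : ∀ X : Subgroup G, X ≠ ⊤ → ∀ S : Subgroup G, IsPGroup q S → S ≤ X →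
      ¬ q ∣ S.relIndex X → IsPNilpotent q (normalizer (centerIn S : Set G)) →
      IsPNilpotent q (normalizer (thompsonSubgroup S : Set G)) → IsPNilpotent q X :=
    fun X hX S hS hSX hi hZ hJ =>
      isPNilpotent_of_relIndex (fun P h1 h2 => ih (Nat.card X)
        (lt_of_le_of_ne (card_le_card_group X) fun h => hX ((card_eq_iff_eq_top X).1 h))
        P h1 h2 rfl) hS hSX hi hZ hJ
  obtain ⟨D, hD, hDp, hDn⟩ := exists_normal_isPGroup_of_not_isPNilpotent hsub
    (isPNilpotent_normalizer_of_sylow (fun _ hf S => centerIn_map hf S) hZ)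
    (isPNilpotent_normalizer_of_sylow (fun _ hf S => thompsonSubgroup_map hf S) hJ) hG
  obtain ⟨H, hHn, hHp, hH⟩ := exists_largest_normal_isPGroup (q := q) (G := G)
  have hHne : H ≠ ⊥ := fun h => hD (le_bot_iff.1 (h ▸ hH D hDn hDp))
  have hHP : H ≤ P := hHp.le_sylow_of_normal P
  have hproper : ∀ X : Subgroup G, P ≤ X → X ≠ ⊤ → IsPNilpotent q X := fun X hPX hX =>
    hsub X hX P P.2 hPX (fun h => P.not_dvd_index (h.trans (relIndex_dvd_index_of_le hPX))) hZ hJ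
  have hsurj := QuotientGroup.mk'_surjective H
  have hker : (QuotientGroup.mk' H).ker = H := QuotientGroup.ker_mk' H
  let Q : Sylow q (G ⧸ H) := P.mapSurjective hsurj
  have hQ : (Q : Subgroup (G ⧸ H)) = (P : Subgroup G).map (QuotientGroup.mk' H) := rfl
  have hQP : (Q : Subgroup (G ⧸ H)).comap (QuotientGroup.mk' H) = P := by
    rw [hQ, comap_map_eq_self (hker.le.trans hHP)]
  have hQne : (Q : Subgroup (G ⧸ H)) ≠ ⊥ := by
    intro h
    have hPH : (P : Subgroup G) = H := by
      rw [← hQP, h, MonoidHom.comap_bot, hker]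
    refine hG (hZ.mono ?_)
    rw [hPH, ← normalizer_eq_top (H := H)]
    exact normalizer_le_normalizer_centerIn H
  -- A normal `A` would pull back to a normal `q`-subgroup larger than `H`; so the preimage of
  -- `N(A)` is proper, and it contains `P`.
  have key : ∀ A : Subgroup (G ⧸ H), A ≠ ⊥ → A ≤ Q →
      normalizer (Q : Set (G ⧸ H)) ≤ normalizer (A : Set (G ⧸ H)) →
      IsPNilpotent q (normalizer (A : Set (G ⧸ H))) := by
    intro A hA hAQ hn
    have hle : (P : Subgroup G) ≤ (normalizer (A : Set (G ⧸ H))).comap (QuotientGroup.mk' H) := by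
      rw [← hQP]
      exact comap_mono (le_normalizer.trans hn)
    rw [← map_comap_eq_self_of_surjective hsurj (normalizer (A : Set (G ⧸ H)))]
    refine (hproper _ hle fun htop => hA ?_).map _
    have hAn : A.Normal := by
      rw [← normalizer_eq_top_iff, ← map_comap_eq_self_of_surjective hsurj (normalizer _), htop,
        map_top_of_surjective _ hsurj]
    have hAH : A.comap (QuotientGroup.mk' H) ≤ H :=
      hH _ inferInstance (P.2.to_le (hQP ▸ comap_mono hAQ))
    rw [← map_comap_eq_self_of_surjective hsurj A, Subgroup.map_eq_bot_iff, hker]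
    exact hAH
  have hquot : IsPNilpotent q (⊤ : Subgroup (G ⧸ H)) := by
    refine ih (Nat.card (G ⧸ H)) ?_ Q
      (key _ (centerIn_ne_bot Q.2 hQne) inf_le_left (normalizer_le_normalizer_centerIn _))
      (key _ (thompsonSubgroup_ne_bot hQne) (thompsonSubgroup_le _)
        (normalizer_le_normalizer_thompsonSubgroup _)) rfl
    rw [card_eq_card_quotient_mul_card_subgroup H]
    exact lt_mul_of_one_lt_right Nat.card_pos ((one_lt_card_iff_ne_bot H).2 hHne)
  have hcn : hquot.complement.Normal := hquot.complement_normal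
  have hmapK := map_comap_eq_self_of_surjective hsurj hquot.complement
  have hHK : H ≤ hquot.complement.comap (QuotientGroup.mk' H) :=
    hker.ge.trans (ker_le_comap _ _)
  have c : LocalConfig P H (hquot.complement.comap (QuotientGroup.mk' H)) :=
    { H_normal := hHn
      K_normal := inferInstance
      H_isPGroup := hHp
      le_H := hH
      H_le_K := hHK
      not_dvd := by
        have := relIndex_ker (hquot.complement.comap (QuotientGroup.mk' H)) (QuotientGroup.mk' H)
        rw [hker, hmapK] at this
        rw [this]
        exact hquot.not_dvd_card_complement
      mem_K := fun x hx => ⟨mem_top _, fun h => hx (h.trans (orderOf_map_dvd _ x))⟩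
      sup_eq_top := by
        have htop : hquot.complement ⊔ Q = ⊤ := top_le_iff.1
          (hquot.le_complement_sup (by rw [relIndex_top_right]; exact Q.not_dvd_index))
        rw [← comap_map_eq_self (f := QuotientGroup.mk' H) (H := _ ⊔ (P : Subgroup G))
          (hker.le.trans (hHK.trans le_sup_left)), Subgroup.map_sup, hmapK, ← hQ, htop, comap_top]
      proper := hproper
      not_isPNilpotent := hG }
  rcases c.centerIn_normal_or_thompsonSubgroup_normal hq with h | h
  · exact hG (normalizer_eq_top_iff.2 h ▸ hZ)
  · exact hG (normalizer_eq_top_iff.2 h ▸ hJ)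

end NormalComplement

end FiniteGroup

/-! ### Fixed-point-free automorphisms of prime order. -/

namespace FiniteGroup

open Subgroup

open MonoidHom (FixedPointFree commutatorMap_apply)

section FixedPointFree

universe u

variable {N : Type u} [Group N] {φ : N →* N} {X : Subgroup N}

/-- The restriction of an endomorphism to an invariant subgroup. -/
def restrictInvariant (φ : N →* N) (X : Subgroup N) (hX : X ≤ X.comap φ) : X →* X :=
  (φ.comp X.subtype).codRestrict X fun x => hX x.2

theorem coe_restrictInvariant_iterate (hX : X ≤ X.comap φ) (n : ℕ) (x : X) :
    (((restrictInvariant φ X hX)^[n] x : X) : N) = φ^[n] x :=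
  Function.Semiconj.iterate_right (f := Subtype.val) (ga := restrictInvariant φ X hX) (gb := φ)
    (fun _ => rfl) n x

theorem restrictInvariant_iterate_eq_id (hX : X ≤ X.comap φ) {n : ℕ} (h : φ^[n] = id) :
    (restrictInvariant φ X hX)^[n] = id :=
  funext fun x => Subtype.ext (by rw [coe_restrictInvariant_iterate, h]; rfl)

theorem fixedPointFree_restrictInvariant (hX : X ≤ X.comap φ) (hφ : FixedPointFree φ) :
    FixedPointFree (restrictInvariant φ X hX) :=
  fun x hx => Subtype.ext (hφ x (congrArg Subtype.val hx))

theorem fixedPointFree_iterate (hφ : FixedPointFree φ) {p i : ℕ} (hp : p.Prime)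
    (h : φ^[p] = id) (hi0 : i ≠ 0) (hip : i < p) : FixedPointFree (φ^[i]) := by
  intro x hx
  have h1 : Function.IsPeriodicPt φ i x := hx
  have h2 : Function.IsPeriodicPt φ p x := congrFun h x
  have h3 := h1.gcd h2
  rw [Nat.Coprime.gcd_eq_one
    (Nat.coprime_of_lt_prime hi0 hip hp).symm] at h3
  exact hφ x h3

theorem centerIn_normal (H : Subgroup N) [H.Normal] : (centerIn H).Normal := by
  rw [← normalizer_eq_top_iff, ← top_le_iff, ← normalizer_eq_top (H := H)]
  exact normalizer_le_normalizer_centerIn H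

variable [Finite N]

theorem map_eq_of_le_comap (hinj : Function.Injective φ) (hX : X ≤ X.comap φ) : X.map φ = X :=
  eq_of_le_of_card_ge (map_le_iff_le_comap.2 hX) (card_map_of_injective hinj).ge

/-- For a fixed coset `xX`, write `x⁻¹φ(x) = mφ(m)⁻¹` with `m ∈ X`; then `xm` is fixed, hence
trivial. -/
theorem fixedPointFree_quotientMap [X.Normal] (hX : X ≤ X.comap φ) (hφ : FixedPointFree φ) :
    FixedPointFree (QuotientGroup.map X X φ hX) := by
  intro y hy
  obtain ⟨x, rfl⟩ := QuotientGroup.mk_surjective y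
  rw [QuotientGroup.map_mk, eq_comm, QuotientGroup.eq] at hy
  obtain ⟨m, hm⟩ := (fixedPointFree_restrictInvariant hX hφ).commutatorMap_surjective ⟨_, hy⟩
  have hm' : (m : N) / φ m = x⁻¹ * φ x := congrArg Subtype.val hm
  have hfix : x * m = 1 := by
    refine hφ _ ?_
    conv_rhs => rw [div_eq_iff_eq_mul.1 hm', mul_assoc, mul_inv_cancel_left]
    exact map_mul φ x m
  rw [QuotientGroup.eq_one_iff, eq_inv_of_mul_eq_one_left hfix]
  exact X.inv_mem m.2

/-- If `φ(P) = gPg⁻¹` and `g⁻¹ = kφ(k)⁻¹`, then `k⁻¹Pk` is invariant. -/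
theorem exists_sylow_le_comap (hφ : FixedPointFree φ) (hinj : Function.Injective φ) (r : ℕ)
    [Fact r.Prime] : ∃ R : Sylow r N, (R : Subgroup N) ≤ (R : Subgroup N).comap φ := by
  let P : Sylow r N := default
  obtain ⟨g, hg⟩ := MulAction.exists_smul_eq N P
    (P.mapSurjective (Finite.surjective_of_injective hinj))
  obtain ⟨k, hk⟩ := hφ.commutatorMap_surjective g⁻¹
  rw [commutatorMap_apply] at hk
  have hg' : (P : Subgroup N).map (MulAut.conj g).toMonoidHom = (P : Subgroup N).map φ :=
    congrArg (Sylow.toSubgroup) hg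
  refine ⟨k⁻¹ • P, ?_⟩
  change (P : Subgroup N).map (MulAut.conj k⁻¹).toMonoidHom ≤
    ((P : Subgroup N).map (MulAut.conj k⁻¹).toMonoidHom).comap φ
  rintro _ ⟨x, hx, rfl⟩
  obtain ⟨y, hy, hxy⟩ : φ x ∈ (P : Subgroup N).map (MulAut.conj g).toMonoidHom :=
    hg' ▸ mem_map_of_mem φ hx
  refine ⟨y, hy, ?_⟩
  have hgk : g = φ k * k⁻¹ := by rw [← inv_inv g, ← hk, inv_div, div_eq_mul_inv]
  simp only [MulEquiv.coe_toMonoidHom, MulAut.conj_apply] at hxy ⊢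
  rw [map_mul, map_mul, map_inv, map_inv, map_inv, ← hxy, hgk]
  group

open scoped IsMulCommutative in
/-- If `φ` is fixed-point-free of prime order, an invariant subgroup of coprime order centralizes
every invariant abelian normal subgroup. -/
theorem commute_of_coprime (hφ : FixedPointFree φ) {p : ℕ} (hp : p.Prime) (h : φ^[p] = id)
    {M R : Subgroup N} [M.Normal] [IsMulCommutative M] (hM : M ≤ M.comap φ) (hR : R ≤ R.comap φ)
    (hco : (Nat.card R).Coprime (Nat.card M)) : M ≤ centralizer (R : Set N) := by
  have := Fintype.ofFinite R
  let c : N →* MulAut M := MulAut.conjNormal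
  let ψ := restrictInvariant φ M hM
  have hψ := fixedPointFree_restrictInvariant hM hφ
  have hψp := restrictInvariant_iterate_eq_id hM h
  -- The product over a `φ`-orbit in `M` is `1`; this is used for `s⁻¹ms` and conjugated back by
  -- `s`.
  have hone : ∀ (m : M) (s : N), ∏ i ∈ Finset.range p, c (s / φ^[i] s) (ψ^[i] m) = 1 := by
    intro m s
    have h1 : ∏ i ∈ Finset.range p, ψ^[i] (c s⁻¹ m) = 1 := hψ.prod_pow_eq_one hψp (c s⁻¹ m)
    have h2 := congrArg (c s) h1
    rw [map_prod, map_one] at h2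
    rw [← h2]
    refine Finset.prod_congr rfl fun i _ => Subtype.ext ?_
    change (MulAut.conjNormal (s / φ^[i] s) (ψ^[i] m) : N) =
      (MulAut.conjNormal s (ψ^[i] (MulAut.conjNormal s⁻¹ m)) : N)
    rw [MulAut.conjNormal_apply, MulAut.conjNormal_apply, coe_restrictInvariant_iterate,
      coe_restrictInvariant_iterate, MulAut.conjNormal_apply, iterate_map_mul, iterate_map_mul,
      inv_inv, iterate_map_inv, div_eq_mul_inv]
    group
  have hfix : ∀ (r : R) (a : M), c r (∏ s : R, c s a) = ∏ s : R, c s a := by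
    intro r a
    rw [map_prod]
    refine Fintype.prod_equiv (Equiv.mulLeft r) _ _ fun s => ?_
    rw [Equiv.coe_mulLeft, Subgroup.coe_mul, map_mul]
    rfl
  -- Multiply `hone` over `s ∈ R`. The factor `i = 0` is `m ^ |R|`. For `i > 0` the map `s ↦ s /
  -- φ^[i] s` permutes `R`, since `φ^[i]` is again fixed-point-free, so the other factors are fixed
  -- by `R`.
  have hpow : ∀ (r : R) (m : M), c r (m ^ Nat.card R) = m ^ Nat.card R := by
    intro r m
    have h1 : ∏ i ∈ Finset.range p, ∏ s : R, c ((s : N) / φ^[i] s) (ψ^[i] m) = 1 := by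
      rw [Finset.prod_comm]
      exact Finset.prod_eq_one fun s _ => hone m s
    obtain ⟨n, rfl⟩ := Nat.exists_eq_succ_of_ne_zero hp.ne_zero
    rw [Finset.prod_range_succ'] at h1
    have h2 : ∏ s : R, c ((s : N) / φ^[0] s) (ψ^[0] m) = m ^ Nat.card R := by
      simp
    rw [h2] at h1
    rw [eq_inv_of_mul_eq_one_right h1, map_inv, map_prod]
    congr 1
    refine Finset.prod_congr rfl fun i hi => ?_
    have hb : Function.Bijective (fun s : R => s / (restrictInvariant φ R hR)^[i + 1] s) := by
      refine Finite.injective_iff_bijective.1 fun x y hxy => ?_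
      have hf := fixedPointFree_iterate hφ hp h i.succ_ne_zero
        (Nat.succ_lt_succ (Finset.mem_range.1 hi))
      let Φ : Monoid.End N := φ
      have := FixedPointFree.commutatorMap_injective (φ := Φ ^ (i + 1))
        (by rwa [Monoid.End.coe_pow]) (a₁ := (x : N)) (a₂ := y) (by
          have := congrArg Subtype.val hxy
          rw [Subgroup.coe_div, Subgroup.coe_div, coe_restrictInvariant_iterate,
            coe_restrictInvariant_iterate] at this
          rw [commutatorMap_apply, commutatorMap_apply, Monoid.End.coe_pow]
          exact this)
      exact Subtype.ext this
    have h3 : ∏ s : R, c ((s : N) / φ^[i + 1] s) (ψ^[i + 1] m) = ∏ s : R, c s (ψ^[i + 1] m) := by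
      refine Fintype.prod_equiv (Equiv.ofBijective _ hb) _ _ fun s => ?_
      rw [Equiv.ofBijective_apply, Subgroup.coe_div, coe_restrictInvariant_iterate]
    rw [h3, hfix]
  intro m hm
  refine mem_centralizer_iff.2 fun r hr => ?_
  obtain ⟨k, hk⟩ := exists_pow_eq_self_of_coprime (x := (⟨m, hm⟩ : M)) (n := Nat.card R)
    (hco.coprime_dvd_right (_root_.orderOf_dvd_natCard _))
  have h1 : c r ⟨m, hm⟩ = ⟨m, hm⟩ := by
    rw [← hk, map_pow, hpow ⟨r, hr⟩]
  have h2 : r * m * r⁻¹ = m := by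
    have := congrArg Subtype.val h1
    rwa [MulAut.conjNormal_apply] at this
  exact mul_inv_eq_iff_eq_mul.1 h2

/-- `A` is the center of the largest normal `q`-subgroup of `N`, for a prime `q` dividing `|M|`; it
need not lie in `M`. -/
theorem exists_abelian_normal (hinj : Function.Injective φ) {M : Subgroup N} [M.Normal]
    (hM : M ≠ ⊥) [Group.IsNilpotent M] :
    ∃ (q : ℕ) (_ : Fact q.Prime) (A : Subgroup N), A ≠ ⊥ ∧ A.Normal ∧ IsMulCommutative A ∧
      IsPGroup q A ∧ A ≤ A.comap φ := by
  obtain ⟨q, hq, hqM⟩ := Nat.exists_prime_and_dvd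
    (fun h => hM (M.card_eq_one.1 h) : Nat.card M ≠ 1)
  have : Fact q.Prime := ⟨hq⟩
  let Q : Sylow q M := default
  have hQn : (Q : Subgroup M).Normal := inferInstance
  have hQc : (Q : Subgroup M).Characteristic := Q.characteristic_of_normal hQn
  have hQne : (Q : Subgroup M).map M.subtype ≠ ⊥ := by
    rw [Ne, map_eq_bot_iff_of_injective _ M.subtype_injective]
    exact Q.ne_bot_of_dvd_card hqM
  obtain ⟨H, hHn, hHp, hH⟩ := exists_largest_normal_isPGroup (q := q) (G := N)
  have hHne : H ≠ ⊥ := fun h => hQne (le_bot_iff.1 (h ▸ hH _ inferInstance (Q.2.map _)))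
  have hHφ : H.map φ = H := map_eq_of_le_comap hinj (map_le_iff_le_comap.1
    (hH _ (hHn.map φ (Finite.surjective_of_injective hinj)) (hHp.map φ)))
  refine ⟨q, this, centerIn H, centerIn_ne_bot hHp hHne, centerIn_normal H,
    ⟨⟨fun a b => Subtype.ext (mem_centralizer_iff.1 b.2.2 a a.2.1)⟩⟩, hHp.to_le inf_le_left, ?_⟩
  rw [← map_le_iff_le_comap, ← centerIn_map hinj, hHφ]

theorem isNilpotent_of_forall_exists_sylow_normal
    (h : ∀ r, Fact r.Prime → ∃ R : Sylow r N, (R : Subgroup N).Normal) : Group.IsNilpotent N := by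
  refine ((Group.isNilpotent_of_finite_tfae (G := N)).out 0 3).2 fun r hr P => ?_
  have : Fact r.Prime := hr
  obtain ⟨R, hR⟩ := h r hr
  have := Sylow.unique_of_normal R hR
  rwa [Subsingleton.elim P R]

/-- For an invariant Sylow subgroup `R`, `RM` is normal. Either `M ≤ R`, or `M` centralizes `R` and
Frattini's argument makes `R` normal. -/
theorem isNilpotent_of_quotient (hφ : FixedPointFree φ) (hinj : Function.Injective φ) {p : ℕ}
    (hp : p.Prime) (h : φ^[p] = id) {q : ℕ} [Fact q.Prime] {M : Subgroup N} [M.Normal]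
    [IsMulCommutative M] (hMq : IsPGroup q M) (hM : M ≤ M.comap φ)
    (hnil : Group.IsNilpotent (N ⧸ M)) : Group.IsNilpotent N := by
  refine isNilpotent_of_forall_exists_sylow_normal fun r hr => ?_
  obtain ⟨R, hR⟩ := exists_sylow_le_comap hφ hinj r
  refine ⟨R, ?_⟩
  let Q : Sylow r (N ⧸ M) := R.mapSurjective (QuotientGroup.mk'_surjective M)
  have hRM : ((R : Subgroup N) ⊔ M).Normal := by
    have hQ : ((Q : Subgroup (N ⧸ M)).comap (QuotientGroup.mk' M)).Normal := inferInstance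
    change (((R : Subgroup N).map (QuotientGroup.mk' M)).comap (QuotientGroup.mk' M)).Normal at hQ
    rwa [comap_map_eq, QuotientGroup.ker_mk'] at hQ
  by_cases hrq : r = q
  · subst hrq
    rwa [sup_eq_left.2 (hMq.le_sylow_of_normal R)] at hRM
  · have hc : M ≤ centralizer ((R : Subgroup N) : Set N) :=
      commute_of_coprime hφ hp h hM hR (IsPGroup.coprime_card_of_ne q r (Ne.symm hrq) _ _ hMq R.2).symm
    rw [← normalizer_eq_top_iff, ← top_le_iff,
      ← R.normalizer_sup_eq_top' (le_sup_left : (R : Subgroup N) ≤ (R : Subgroup N) ⊔ M)]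
    exact sup_le le_rfl (sup_le le_normalizer (hc.trans (centralizer_le_normalizer _)))

/-- A finite group with a fixed-point-free automorphism of prime order is nilpotent. -/
theorem isNilpotent_of_fixedPointFree {N : Type u} [Group N] [Finite N] {φ : N →* N}
    (hφ : FixedPointFree φ) {p : ℕ} (hp : p.Prime) (h : φ^[p] = id) : Group.IsNilpotent N := by
  induction hn : Nat.card N using Nat.strong_induction_on generalizing N with
  | _ n ih =>
  subst hn
  have hinj : Function.Injective φ := by
    obtain ⟨n, rfl⟩ := Nat.exists_eq_succ_of_ne_zero hp.ne_zero
    rw [Function.iterate_succ] at h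
    exact Function.Injective.of_comp (f := φ^[n]) (h ▸ Function.injective_id)
  have hsub : ∀ X : Subgroup N, X ≠ ⊤ → X ≤ X.comap φ → Group.IsNilpotent X := fun X hX hXφ =>
    ih (Nat.card X)
      (lt_of_le_of_ne (card_le_card_group X) fun h => hX ((card_eq_iff_eq_top X).1 h))
      (fixedPointFree_restrictInvariant hXφ hφ) (restrictInvariant_iterate_eq_id hXφ h) rfl
  by_cases hM : ∃ M : Subgroup N, M.Normal ∧ M ≠ ⊥ ∧ M ≠ ⊤ ∧ M ≤ M.comap φ
  · obtain ⟨M, hMn, hM1, hMt, hMφ⟩ := hM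
    have := hsub M hMt hMφ
    obtain ⟨q, hq, A, hA, hAn, hAc, hAq, hAφ⟩ := exists_abelian_normal hinj hM1
    refine isNilpotent_of_quotient hφ hinj hp h hAq hAφ
      (ih _ ?_ (fixedPointFree_quotientMap hAφ hφ) ?_ rfl)
    · rw [card_eq_card_quotient_mul_card_subgroup A]
      exact lt_mul_of_one_lt_right Nat.card_pos ((one_lt_card_iff_ne_bot A).2 hA)
    · funext y
      obtain ⟨x, rfl⟩ := QuotientGroup.mk_surjective y
      rw [← (Function.Semiconj.iterate_right (f := QuotientGroup.mk (s := A)) (ga := φ)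
        (gb := QuotientGroup.map A A φ hAφ) (fun _ => rfl) p) x, h]
      rfl
  push Not at hM
  by_cases h2 : IsPGroup 2 N
  · exact h2.isNilpotent
  obtain ⟨q, hq, hqN, hq2⟩ : ∃ q, q.Prime ∧ q ∣ Nat.card N ∧ q ≠ 2 := by
    by_contra! hall
    exact h2 (IsPGroup.of_card
      (Nat.eq_prime_pow_of_unique_prime_dvd Nat.card_pos.ne' fun hd hdN => hall _ hd hdN))
  have : Fact q.Prime := ⟨hq⟩
  by_cases hqG : IsPGroup q N
  · exact hqG.isNilpotent
  have hnotop : ∀ X : Subgroup N, IsPGroup q X → X ≠ ⊤ := by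
    rintro X hX rfl
    exact hqG (hX.of_equiv topEquiv)
  obtain ⟨P, hP⟩ := exists_sylow_le_comap hφ hinj q
  have hPφ := map_eq_of_le_comap hinj hP
  have hPne : (P : Subgroup N) ≠ ⊥ := P.ne_bot_of_dvd_card hqN
  have key : ∀ E : Subgroup N, E ≠ ⊥ → E ≤ P → E.map φ = E →
      IsPNilpotent q (normalizer (E : Set N)) := by
    intro E hE hEP hEφ
    rw [← isPNilpotent_top_iff]
    have : Group.IsNilpotent (normalizer (E : Set N)) := by
      refine hsub _ (fun htop => ?_) ?_
      · refine hM E (normalizer_eq_top_iff.1 htop) hE (hnotop E (P.2.to_le hEP)) ?_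
        rw [← map_le_iff_le_comap, hEφ]
      · rw [← map_le_iff_le_comap]
        refine (le_normalizer_map φ).trans ?_
        rw [hEφ]
    exact isPNilpotent_top_of_isNilpotent q
  have hPN : IsPNilpotent q (⊤ : Subgroup N) := isPNilpotent_top_of_normalizer hq2 P
    (key _ (centerIn_ne_bot P.2 hPne) inf_le_left (by rw [← centerIn_map hinj, hPφ]))
    (key _ (thompsonSubgroup_ne_bot hPne) (thompsonSubgroup_le _)
      (by rw [← thompsonSubgroup_map hinj, hPφ]))
  have hbot : hPN.complement = ⊥ := by
    by_contra hne
    refine hM hPN.complement hPN.complement_normal hne (fun htop => ?_) fun x hx =>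
      ⟨mem_top _, by rw [orderOf_injective φ hinj]; exact hx.2⟩
    have := hPN.not_dvd_card_complement
    rw [htop, card_top] at this
    exact this hqN
  have hle := hPN.le_complement_sup (S := P) (by rw [relIndex_top_right]; exact P.not_dvd_index)
  rw [hbot, bot_sup_eq, top_le_iff] at hle
  exact absurd hle (hnotop P P.2)

end FixedPointFree

end FiniteGroup

/-! ### Frobenius kernels and the Fitting subgroup. -/

namespace FrobeniusTriple

open Subgroup

section Kernel

universe u

variable {G : Type u} [Group G]

theorem fitting_normal : (fitting G).Normal := sSup_normal fun _ hK => hK.1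

theorem IsFrobeniusKernel.ne_top {N : Subgroup G} (h : IsFrobeniusKernel N) : N ≠ ⊤ := by
  rintro rfl
  obtain ⟨H, hH, hc⟩ := h.exists_compl
  exact hH (by simpa using hc.disjoint)

theorem IsFrobeniusKernel.le_of_disjoint {N K : Subgroup G} (h : IsFrobeniusKernel N)
    (hK : K.Normal) (hKN : Disjoint K N) : K ≤ N := by
  obtain ⟨⟨n, hn⟩, hn1⟩ := ne_bot_iff_exists_ne_one.1 h.ne_bot
  refine le_trans (fun k hk => ?_) (h.centralizer_le n hn fun h => hn1 (Subtype.ext h))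
  exact mem_centralizer_singleton_iff.2
    (commute_of_normal_of_disjoint K N hK h.normal hKN k n hk hn)

/-- `Z(K)` meets `N`, since otherwise it commutes with `N` and so lies in `N`. For `1 ≠ y ∈ Z(K) ⊓
N`, `K ≤ C(y) ≤ N`. -/
theorem IsFrobeniusKernel.le_of_isNilpotent {N K : Subgroup G} (h : IsFrobeniusKernel N)
    (hK : K.Normal) (hKn : Group.IsNilpotent K) : K ≤ N := by
  rcases eq_or_ne K ⊥ with rfl | hK1
  · exact bot_le
  have : Nontrivial K := K.nontrivial_iff_ne_bot.2 hK1
  obtain ⟨⟨z, hz⟩, hz1⟩ := ne_bot_iff_exists_ne_one.1 (Group.IsNilpotent.center_ne_bot (G := K))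
  have hzc : (z : G) ∈ FiniteGroup.centerIn K := ⟨z.2, mem_centralizer_iff.2 fun x hx =>
    congrArg Subtype.val (mem_center_iff.1 hz ⟨x, hx⟩)⟩
  have hz1' : (z : G) ≠ 1 := fun h => hz1 (Subtype.ext (Subtype.ext h))
  obtain ⟨y, ⟨hyc, hyN⟩, hy1⟩ : ∃ y ∈ FiniteGroup.centerIn K ⊓ N, y ≠ 1 := by
    by_contra! hall
    have hd : Disjoint (FiniteGroup.centerIn K) N :=
      disjoint_def.2 fun hx hxN => hall _ ⟨hx, hxN⟩
    have hle := h.le_of_disjoint (FiniteGroup.centerIn_normal K) hd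
    exact hz1' (disjoint_def.1 hd hzc (hle hzc))
  exact le_trans (fun k hk => mem_centralizer_singleton_iff.2
    (mem_centralizer_iff.1 hyc.2 k hk)) (h.centralizer_le y hyN hy1)

variable [Finite G]

theorem IsFrobeniusKernel.isNilpotent {N : Subgroup G} (h : IsFrobeniusKernel N) :
    Group.IsNilpotent N := by
  have := h.normal
  obtain ⟨H, hH, hc⟩ := h.exists_compl
  obtain ⟨p, hp, hpH⟩ := Nat.exists_prime_and_dvd
    (fun h => hH (H.card_eq_one.1 h) : Nat.card H ≠ 1)
  have : Fact p.Prime := ⟨hp⟩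
  obtain ⟨⟨x, hx⟩, hxp⟩ := exists_prime_orderOf_dvd_card' p hpH
  rw [orderOf_mk] at hxp
  let φ : N →* N := (MulAut.conjNormal x : MulAut N).toMonoidHom
  have hφ : ∀ (k : ℕ) (n : N), φ^[k] n = (MulAut.conjNormal (x ^ k) : MulAut N) n := by
    intro k n
    induction k with
    | zero => simp
    | succ k ih => rw [Function.iterate_succ_apply', ih, pow_succ', map_mul]; rfl
  refine FiniteGroup.isNilpotent_of_fixedPointFree (φ := φ) (fun n hn => ?_) hp ?_
  · by_contra hn1
    have hcomm : x * n * x⁻¹ = n := by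
      rw [← MulAut.conjNormal_apply]
      exact congrArg Subtype.val hn
    have hxN : x ∈ N := h.centralizer_le n n.2 (fun h => hn1 (Subtype.ext h))
      (mem_centralizer_singleton_iff.2 (mul_inv_eq_iff_eq_mul.1 hcomm))
    have hx1 : x = 1 := disjoint_def.1 hc.disjoint hxN hx
    rw [hx1, orderOf_one] at hxp
    exact hp.ne_one hxp.symm
  · funext n
    rw [hφ, ← hxp, pow_orderOf_eq_one, map_one]
    rfl

theorem IsFrobeniusKernel.fitting_eq {N : Subgroup G} (h : IsFrobeniusKernel N) :
    fitting G = N :=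
  le_antisymm (sSup_le fun _ hK => h.le_of_isNilpotent hK.1 hK.2)
    (le_sSup ⟨h.normal, h.isNilpotent⟩)

/-- Let `x ∈ F` have order `p` and lie in a Sylow subgroup `P`. Then `Z(P)` centralizes `x`, so it
lies in `F`, and `P` centralizes `Z(P)`, so `P ≤ F`. -/
theorem coprime_card_index_of_C_le {F : Subgroup G} [F.Normal] (hC : C F ≤ F) :
    (Nat.card F).Coprime F.index := by
  refine Nat.coprime_of_dvd fun p hp hpF hpi => ?_
  have : Fact p.Prime := ⟨hp⟩
  obtain ⟨⟨x, hxF⟩, hx⟩ := exists_prime_orderOf_dvd_card' p hpF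
  rw [orderOf_mk] at hx
  have hx1 : x ≠ 1 := by
    rintro rfl
    rw [orderOf_one] at hx
    exact hp.ne_one hx.symm
  have hxp : IsPGroup p (zpowers x) :=
    IsPGroup.of_card (n := 1) (by rw [Nat.card_zpowers, hx, pow_one])
  obtain ⟨P, hP⟩ := hxp.exists_le_sylow
  have hxP : x ∈ (P : Subgroup G) := hP (mem_zpowers x)
  obtain ⟨⟨z, hzP, hzc⟩, hz1⟩ := ne_bot_iff_exists_ne_one.1
    (FiniteGroup.centerIn_ne_bot P.2 fun h => hx1 (mem_bot.1 (h ▸ hxP)))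
  rw [C_le_iff] at hC
  have hzF : z ∈ F := hC x hxF hx1 z (mem_centralizer_iff.1 hzc x hxP)
  have hPF : (P : Subgroup G) ≤ F := fun y hy =>
    hC z hzF (fun h => hz1 (Subtype.ext h)) y (mem_centralizer_iff.1 hzc y hy).symm
  exact P.not_dvd_index (hpi.trans (index_dvd_of_le hPF))

theorem isFrobeniusGroup_iff : IsFrobeniusGroup G ↔
    fitting G ≠ ⊥ ∧ fitting G ≠ ⊤ ∧ C (fitting G) = fitting G := by
  have hFn : (fitting G).Normal := fitting_normal
  constructor
  · rintro ⟨N, hN⟩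
    rw [hN.fitting_eq]
    exact ⟨hN.ne_bot, hN.ne_top,
      le_antisymm (iSup₂_le fun x hx => hN.centralizer_le x hx.1 hx.2) (le_C N)⟩
  · rintro ⟨h1, ht, hC⟩
    refine ⟨fitting G, hFn, h1, ?_, fun x hx hx1 y hy =>
      C_le_iff.1 hC.le x hx hx1 y (mem_centralizer_singleton_iff.1 hy).symm⟩
    obtain ⟨H, hH⟩ := exists_right_complement'_of_coprime (coprime_card_index_of_C_le hC.le)
    refine ⟨H, ?_, hH⟩
    rintro rfl
    exact ht (isComplement'_bot_right.1 hH)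

/-- Both sides amount to `C(G|F) ≤ F`, as the opposite inclusions always hold. -/
theorem C_fitting_eq_iff : C (fitting G) = fitting G ↔ fitting G = I (fitting G) := by
  have hFn : (fitting G).Normal := fitting_normal
  rw [le_antisymm_iff, and_iff_left (le_C _), C_le_iff_le_I hFn, le_antisymm_iff,
    and_iff_left ((le_C _).trans (C_I_le _))]

end Kernel

end FrobeniusTriple

theorem mainTheorem11 (G : Type*) [Group G] [Finite G] :
    -- `C(G|·)` and `I(G|·)` are maps on the lattice of normal subgroups
    (∀ M : Subgroup G, M.Normal → (FrobeniusTriple.C M).Normal) ∧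
    (∀ N : Subgroup G, N.Normal → (FrobeniusTriple.I N).Normal) ∧
    -- (1)
    (∀ M N : Subgroup G, M.Normal → N.Normal →
      (FrobeniusTriple.C M ≤ N ↔ M ≤ FrobeniusTriple.I N)) ∧
    -- (2)
    (∀ M₁ M₂ : Subgroup G, M₁.Normal → M₂.Normal →
      FrobeniusTriple.C (M₁ ⊔ M₂) = FrobeniusTriple.C M₁ ⊔ FrobeniusTriple.C M₂) ∧
    -- (3)
    (∀ N₁ N₂ : Subgroup G, N₁.Normal → N₂.Normal →
      FrobeniusTriple.I (N₁ ⊓ N₂) = FrobeniusTriple.I N₁ ⊓ FrobeniusTriple.I N₂) ∧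
    -- (4)
    (∀ M : Subgroup G, M.Normal → M ≤ FrobeniusTriple.I (FrobeniusTriple.C M)) ∧
    (∀ N : Subgroup G, N.Normal → FrobeniusTriple.C (FrobeniusTriple.I N) ≤ N) ∧
    -- (5)
    (∀ N : Subgroup G, N.Normal → N ≠ ⊤ → Subgroup.center G ⊓ FrobeniusTriple.I N = ⊥) ∧
    -- (6)
    (∀ M N : Subgroup G, M.Normal → N.Normal → M ≠ ⊥ → N ≠ ⊤ →
      (FrobeniusTriple.IsFrobeniusTriple N M ↔ FrobeniusTriple.C M ≤ N)) ∧
    -- (7)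
    (FrobeniusTriple.IsFrobeniusGroup G ↔
      FrobeniusTriple.fitting G ≠ ⊥ ∧ FrobeniusTriple.fitting G ≠ ⊤ ∧
        FrobeniusTriple.C (FrobeniusTriple.fitting G) = FrobeniusTriple.fitting G) ∧
    (FrobeniusTriple.IsFrobeniusGroup G ↔
      FrobeniusTriple.fitting G ≠ ⊥ ∧ FrobeniusTriple.fitting G ≠ ⊤ ∧
        FrobeniusTriple.fitting G = FrobeniusTriple.I (FrobeniusTriple.fitting G)) ∧
    -- (8)
    (∀ M : Subgroup G, M.Normal → M ≠ ⊥ →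
      Subgroup.center G ⊔ M ≤ FrobeniusTriple.V M ∧
        FrobeniusTriple.V M ≤ FrobeniusTriple.C M) ∧
    (∀ N : Subgroup G, N.Normal → N ≠ ⊤ →
      FrobeniusTriple.I N ≤ FrobeniusTriple.U N ∧
        FrobeniusTriple.U N ≤ N ⊓ commutator G) :=
  ⟨fun _ hM => FrobeniusTriple.C_normal hM, fun N _ => FrobeniusTriple.I_normal N,
    fun _ _ hM _ => FrobeniusTriple.C_le_iff_le_I hM,
    fun _ _ h₁ h₂ => FrobeniusTriple.C_sup h₁ h₂,
    fun N₁ N₂ _ _ => FrobeniusTriple.I_inf N₁ N₂,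
    fun _ hM => (FrobeniusTriple.C_le_iff_le_I hM).1 le_rfl,
    fun N _ => FrobeniusTriple.C_I_le N,
    fun _ _ hN => FrobeniusTriple.center_inf_I hN,
    fun _ _ hM hN h1 hN1 => FrobeniusTriple.isFrobeniusTriple_iff hM hN h1 hN1,
    FrobeniusTriple.isFrobeniusGroup_iff,
    FrobeniusTriple.isFrobeniusGroup_iff.trans
      (and_congr_right' (and_congr_right' FrobeniusTriple.C_fitting_eq_iff)),
    fun _ hM h1 => ⟨FrobeniusTriple.center_sup_le_V hM h1, FrobeniusTriple.V_le_C hM⟩,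
    fun N _ hN => ⟨FrobeniusTriple.I_le_U N, FrobeniusTriple.U_le hN⟩⟩
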